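/- Let $G=\frac{\sqrt5+1}{2}$, $g=\frac{\sqrt5-1}{2}$, let $\alpha\in[g,G]$ and $I_\alpha=[\alpha-2,\alpha)$. Let $\varphi_\alpha:I_\alpha\to I_\alpha$ be given by $\varphi_\alpha(0)=0$ and $$\varphi_\alpha(x)=\frac1{|x|}-d_\alpha(x),\qquad d_\alpha(x)=2\left\lfloor\frac1{2|x|}+\frac{1-\alpha}2\right\rfloor+1\qquad(x\ne0).$$ Put $$\Omega_\alpha=\big(I_\alpha\times[0,2-G)\big)\cup\big((\tfrac1\alpha-1,\alpha)\times(2-G,1]\big)\cup\big([\tfrac1{2-\alpha}-1,\alpha)\times[1,G)\big),$$ where an interval whose left endpoint is not smaller than its right endpoint is empty, and let $\nu_\alpha$ be the measure on the Borel $\sigma$-algebra $\mathcal B_{I_\alpha}$ of $I_\alpha$ given by $$\nu_\alpha(E)=\frac1{3\log G}\iint_{\{(x,y)\in\Omega_\alpha:\,x\in E\}}\frac{dx\,dy}{(1+xy)^2}.$$ Then $\nu_\alpha$ is a $\varphi_\alpha$-invariant probability measure that is absolutely continuous with respect to Lebesgue measure, and $\varphi_\alpha$ is exact with respect to $\nu_\alpha$: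 every set $A$ in the tail $\sigma$-algebra $\bigcap_{n\ge0}\varphi_\alpha^{-n}\mathcal B_{I_\alpha}$ satisfies $\nu_\alpha(A)=0$ or $\nu_\alpha(I_\alpha\setminus A)=0$. Moreover $\varphi_\alpha$ is mixing of all orders: for every $r\ge0$ and all $A_0,\dots,A_r\in\mathcal B_{I_\alpha}$, $$\nu_\alpha\Big(\bigcap_{i=0}^r\varphi_\alpha^{-n_i}A_i\Big)\longrightarrow\prod_{i=0}^r\nu_\alpha(A_i)\qquad\text{as }\min_{1\le i\le r}(n_i-n_{i-1})\to\infty .$$ -/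

import Mathlib

open MeasureTheory Set

namespace OddCF

/-- The golden ratio `G = (√5 + 1) / 2`. -/
noncomputable def G : ℝ := (√5 + 1) / 2

/-- The small golden ratio `g = (√5 - 1) / 2`. -/
noncomputable def g : ℝ := (√5 - 1) / 2

/-- The interval `I_α = [α - 2, α)`. -/
def I (α : ℝ) : Set ℝ := Ico (α - 2) α

/-- The odd digit `d_α(x) = 2 ⌊1 / (2|x|) + (1 - α) / 2⌋ + 1`. -/
noncomputable def digit (α x : ℝ) : ℤ := 2 * ⌊1 / (2 * |x|) + (1 - α) / 2⌋ + 1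

open Classical in
/-- The formula for `φ_α` as a function on the real line: `φ_α(0) = 0` and
`φ_α(x) = 1 / |x| - d_α(x)` for `x ≠ 0`. -/
noncomputable def phiReal (α x : ℝ) : ℝ := if x = 0 then 0 else 1 / |x| - digit α x

theorem mapsTo_phiReal {α : ℝ} (hα : α ∈ Icc g G) : MapsTo (phiReal α) (I α) (I α) := by
  have h1 : (2 : ℝ) < √5 := by
    rw [Real.lt_sqrt (by norm_num)]; norm_num
  have h2 : √5 < 3 := by
    rw [Real.sqrt_lt' (by norm_num)]; norm_num
  obtain ⟨hg, hG⟩ := hα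
  unfold g at hg
  unfold G at hG
  intro x _
  unfold phiReal I digit
  split_ifs with hx
  · constructor <;> linarith
  · have hx' : |x| ≠ 0 := abs_ne_zero.mpr hx
    have e : 1 / |x| = 2 * (1 / (2 * |x|)) := by field_simp
    have f1 := Int.floor_le (1 / (2 * |x|) + (1 - α) / 2)
    have f2 := Int.lt_floor_add_one (1 / (2 * |x|) + (1 - α) / 2)
    push_cast
    constructor <;> linarith

/-- The transformation `φ_α : I_α → I_α`, for `g ≤ α ≤ G`. -/
noncomputable def phi (α : ℝ) (hα : α ∈ Icc g G) : I α → I α :=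
  (mapsTo_phiReal hα).restrict (phiReal α) (I α) (I α)

/-- The planar region `Ω_α`. The numbers `1 / α - 1` and `1 / (2 - α) - 1` are the images of the
endpoints `α` and `α - 2` under the branch of `φ_α` with digit `1`; for `α = g` the second
rectangle is empty and for `α = G` the third one is empty. -/
noncomputable def Omega (α : ℝ) : Set (ℝ × ℝ) :=
  I α ×ˢ Ico 0 (2 - G) ∪
    Ioo (1 / α - 1) α ×ˢ Ioc (2 - G) 1 ∪
      Ico (1 / (2 - α) - 1) α ×ˢ Ico 1 G

/-- The measure `dμ_α = (1 + x y)⁻² dx dy` on `Ω_α` (extended by zero to the plane). -/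
noncomputable def mu (α : ℝ) : Measure (ℝ × ℝ) :=
  ((volume : Measure (ℝ × ℝ)).restrict (Omega α)).withDensity
    fun p => ENNReal.ofReal (((1 + p.1 * p.2) ^ 2)⁻¹)

/-- The normalized measure `(3 log G)⁻¹ μ_α`. -/
noncomputable def muTilde (α : ℝ) : Measure (ℝ × ℝ) :=
  ENNReal.ofReal ((3 * Real.log G)⁻¹) • mu α

/-- The measure `ν_α` on `I_α`: the image of `(3 log G)⁻¹ μ_α` under `(x, y) ↦ x`. -/
noncomputable def nu (α : ℝ) : Measure (I α) :=
  ((muTilde α).map Prod.fst).comap Subtype.val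

variable {X : Type*} [m : MeasurableSpace X]

/-- The tail σ-algebra `⋂ₙ T⁻ⁿ 𝓑` of a transformation `T`. -/
@[reducible] def tailSigmaAlgebra (T : X → X) : MeasurableSpace X :=
  ⨅ n : ℕ, MeasurableSpace.comap (T^[n]) m

/-- `T` is an exact endomorphism of `(X, μ)`: it preserves `μ`, and its tail σ-algebra
consists of null and co-null sets only. -/
def IsExact (T : X → X) (μ : Measure X) : Prop :=
  MeasurePreserving T μ μ ∧
    ∀ A : Set X, MeasurableSet[tailSigmaAlgebra T] A → μ A = 0 ∨ μ Aᶜ = 0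

/-- `T` is mixing of all orders with respect to the invariant measure `μ`: for every `r` and all
measurable `A₀, …, Aᵣ`, the measure of `⋂ᵢ T^{-nᵢ} Aᵢ` tends to `∏ᵢ μ(Aᵢ)` as the gaps
`n₁ - n₀, …, nᵣ - nᵣ₋₁` all tend to infinity. -/
def IsMixingOfAllOrders (T : X → X) (μ : Measure X) : Prop :=
  MeasurePreserving T μ μ ∧
    ∀ (r : ℕ) (A : Fin (r + 1) → Set X), (∀ i, MeasurableSet (A i)) →
      ∀ ε : ℝ, 0 < ε → ∃ N : ℕ, ∀ n : Fin (r + 1) → ℕ,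
        (∀ i : Fin r, n i.castSucc + N ≤ n i.succ) →
          |μ.real (⋂ i, T^[n i] ⁻¹' A i) - ∏ i, μ.real (A i)| < ε

end OddCF

namespace OddCF

section

variable {α r : ℝ}

/-! Invariance. Integrating `(1 + x y)⁻²` over the fibres of `Omega α` gives the density `dens`.
Writing `t = 2k+1+w`, the two preimages `±1/t` of `w` contribute `1/t - tail (t+2)` and `tail t -
1/t` to the transfer operator. Hence the digits `2k+1 ≥ 3`, whose branches are full, telescope to
`tail (3+w)`, and the two incomplete branches of digit `1` supply the rest of `dens w`
(`hasSum_transferTerm`). A second integration gives logarithms, and the mass is `3 log G`.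

Exactness. Two consecutive points of an orbit have product at most `7/8` in absolute value, so
inverse branches of `φ^n` contract like `(7/8)^n` with bounded distortion wherever they exist on a
ball of fixed radius `r`. There is no Markov partition, so existence is not automatic. It holds if
the orbit keeps a geometrically shrinking margin from the endpoints (`FarFromEndpoints`), which
fails at a given time only on a set of measure `O(r)`, uniformly in `n`, because the invariant
density is bounded.

Moreover every interval eventually covers almost all of `I α` with a lower bound on measure
(`spreads_Ioo`): it contains a rational, rational orbits descend to `0` by decreasing height, and
near `0` all branches are full.

Let `A = φ^{-n} B_n` for all `n`, with `ν(A) > 0`. Take a density point `x` of `A` that is far from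
the endpoints at infinitely many times. Distortion control makes the complement of `B_n` small in
the ball of radius `r` about `φ^n x`; spreading that ball makes the complement of `B_{n+k}` small in
all of `I α`. By invariance it has the measure of the complement of `A`, which is therefore null
(`realNu_eq_zero_or_compl`).

Mixing. Functions measurable for every `T⁻ⁿ 𝓑` are constant, so `1_A - μ(A)` is nearly orthogonal to
`L²(T⁻ᴺ 𝓑)` for some `N`. This decorrelates `A` from `T⁻ⁿ C` uniformly in `C`, and taking for `C`
the intersection of the later events gives all orders by induction. -/

theorem G_sq : G ^ 2 = G + 1 := by
  have h : √5 ^ 2 = 5 := Real.sq_sqrt (by norm_num)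
  unfold G; linarith

theorem G_gt : 1.618 < G := by
  have h : (2.236 : ℝ) < √5 := by
    rw [Real.lt_sqrt (by norm_num)]; norm_num
  unfold G; linarith

theorem G_lt : G < 1.6181 := by
  have h : √5 < (2.2362 : ℝ) := by
    rw [Real.sqrt_lt' (by norm_num)]; norm_num
  unfold G; linarith

theorem g_eq : g = G - 1 := by
  unfold g G; ring

/-! ### Digits and one-step inverse branches -/

theorem bounds_of_mem (hα : α ∈ Icc g G) : G - 1 ≤ α ∧ α ≤ G := by
  rw [← g_eq]; exact hα

theorem phiReal_mem (hα : α ∈ Icc g G) {x : ℝ} (hx : x ∈ I α) : phiReal α x ∈ I α :=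
  mapsTo_phiReal hα hx

theorem abs_le_G_of_mem (hα : α ∈ Icc g G) {x : ℝ} (hx : x ∈ I α) : |x| ≤ G := by
  obtain ⟨h1, h2⟩ := bounds_of_mem hα
  have := G_gt
  obtain ⟨hx1, hx2⟩ := hx
  rw [abs_le]; constructor <;> linarith

theorem exists_digit_eq (hα : α ∈ Icc g G) {x : ℝ} (hx : x ∈ I α) (hx0 : x ≠ 0) :
    ∃ k : ℕ, digit α x = 2 * k + 1 := by
  have hG := abs_le_G_of_mem hα hx
  obtain ⟨h1, h2⟩ := bounds_of_mem hα
  have hp : 0 < |x| := abs_pos.mpr hx0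
  have h0 : 0 ≤ ⌊1 / (2 * |x|) + (1 - α) / 2⌋ := by
    rw [Int.floor_nonneg]
    have : 1 / (2 * |x|) + (1 - α) / 2 = (1 + |x| * (1 - α)) / (2 * |x|) := by
      field_simp
    rw [this]
    apply div_nonneg _ (by positivity)
    nlinarith [G_sq, G_gt]
  obtain ⟨k, hk⟩ := Int.eq_ofNat_of_zero_le h0
  exact ⟨k, by unfold digit; rw [hk]⟩

theorem one_div_abs_eq {x : ℝ} (hx0 : x ≠ 0) : 1 / |x| = digit α x + phiReal α x := by
  unfold phiReal; rw [if_neg hx0]; ring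

/-- The inverse branches: `ε / (2k+1+w)` has digit `2k+1` and is mapped to `w`. -/
theorem digit_branch {w z : ℝ} (hw : w ∈ I α) {k : ℕ}
    (hz : |z| = 1 / (2 * k + 1 + w)) : digit α z = 2 * k + 1 := by
  obtain ⟨hw1, hw2⟩ := hw
  have : ⌊1 / (2 * |z|) + (1 - α) / 2⌋ = k := by
    have e : 1 / (2 * |z|) = (2 * k + 1 + w) / 2 := by
      rw [one_div, mul_inv, hz]; simp only [one_div, inv_inv]; ring
    rw [e, Int.floor_eq_iff]
    push_cast
    constructor <;> linarith
  unfold digit; rw [this]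

theorem phiReal_branch {w z : ℝ} (hw : w ∈ I α) {k : ℕ} (hz0 : z ≠ 0)
    (hz : |z| = 1 / (2 * k + 1 + w)) : phiReal α z = w := by
  have := one_div_abs_eq (α := α) hz0
  rw [digit_branch hw hz, hz] at this
  simp only [one_div, inv_inv] at this
  push_cast at this
  linarith

/-- Along an orbit of length two the product of the absolute values is bounded by `7 / 8`. -/
theorem abs_branch_bounds (hα : α ∈ Icc g G) {w : ℝ} (hw : w ∈ I α) {k : ℕ}
    (h : 4 / 7 ≤ 2 * k + 1 + w) :
    1 / (2 * k + 1 + w) ≤ 7 / 4 ∧ 1 / (2 * k + 1 + w) * |w| ≤ 7 / 8 := by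
  obtain ⟨h1, h2⟩ := bounds_of_mem hα
  obtain ⟨hw1, hw2⟩ := hw
  have := G_gt
  have := G_lt
  have hp : 0 < 2 * k + 1 + w := by linarith
  refine ⟨by rw [div_le_iff₀ hp]; linarith, ?_⟩
  rw [one_div_mul_eq_div, div_le_iff₀ hp]
  -- For `k = 0` the ratio is at most `3/4`, because `w ≥ -3/7`. The extreme case is `k = 1` with
  -- `w` near `G - 3`, where it is about `0.854`.
  rcases Nat.eq_zero_or_pos k with rfl | hk
  · simp only [Nat.cast_zero] at *
    rcases abs_cases w with ⟨e, _⟩ | ⟨e, _⟩ <;> rw [e] <;> linarith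
  · have hk' : (1 : ℝ) ≤ k := by exact_mod_cast hk
    rcases abs_cases w with ⟨e, _⟩ | ⟨e, _⟩ <;> rw [e] <;> linarith

theorem measurable_digit : Measurable (digit α) := by
  unfold digit
  have h : Measurable fun x : ℝ => ⌊1 / (2 * |x|) + (1 - α) / 2⌋ := by
    apply Int.measurable_floor.comp
    fun_prop
  exact (measurable_of_countable (fun n : ℤ => 2 * n + 1)).comp h

theorem measurable_phiReal : Measurable (phiReal α) := by
  unfold phiReal
  refine Measurable.ite (measurableSet_singleton 0) measurable_const ?_
  have h : Measurable fun x : ℝ => ((digit α x : ℤ) : ℝ) :=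
    (measurable_of_countable (fun n : ℤ => (n : ℝ))).comp measurable_digit
  exact Measurable.sub (by fun_prop) h

theorem measurableSet_I : MeasurableSet (I α) := measurableSet_Ico

/-! ### Inverse branches of iterates: contraction and bounded distortion -/

/-- The inverse branch of `φ_α^n` along the orbit of `x`. -/
noncomputable def psi (α : ℝ) : ℕ → ℝ → ℝ → ℝ
  | 0, _, w => w
  | n + 1, x, w => x / |x| / (digit α x + psi α n (phiReal α x) w)

/-- The absolute value of the derivative of `psi`. -/
noncomputable def psiDeriv (α : ℝ) : ℕ → ℝ → ℝ → ℝ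
  | 0, _, _ => 1
  | n + 1, x, w => psi α (n + 1) x w ^ 2 * psiDeriv α n (phiReal α x) w

/-- The orbit of `x` up to time `n` avoids `0` and stays away from the endpoints of `I α`, by a
margin decreasing geometrically as one goes back in time. -/
def FarFromEndpoints (α r : ℝ) (n : ℕ) (x : ℝ) : Prop :=
  ∀ i ≤ n, (phiReal α)^[i] x ≠ 0 ∧ α - 2 + 4 * (7 / 8) ^ (n - i) * r < (phiReal α)^[i] x ∧
    (phiReal α)^[i] x < α - 4 * (7 / 8) ^ (n - i) * r

theorem FarFromEndpoints.tail {n : ℕ} {x : ℝ} (h : FarFromEndpoints α r (n + 1) x) :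
    FarFromEndpoints α r n (phiReal α x) := by
  intro i hi
  have := h (i + 1) (by omega)
  rwa [Nat.add_sub_add_right, Function.iterate_succ_apply] at this

theorem FarFromEndpoints.ne_zero {n : ℕ} {x : ℝ} (h : FarFromEndpoints α r n x) : x ≠ 0 :=
  (h 0 (Nat.zero_le _)).1

/-- The margin required at time `i` is the bound `4 (7/8)^(n-i) r` on the size of the pull-back to
time `i` of a radius-`r` ball at time `n`. So pulled-back balls never leave `I α`. -/
theorem FarFromEndpoints.mem_of_abs_sub_le {n : ℕ} {x z : ℝ} (h : FarFromEndpoints α r n x)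
    (hz : |z - x| ≤ 4 * (7 / 8) ^ n * r) : z ∈ I α := by
  have := (h 0 (Nat.zero_le _)).2
  simp only [Nat.sub_zero, Function.iterate_zero, id] at this
  rw [abs_le] at hz
  constructor <;> linarith

theorem FarFromEndpoints.mem {n : ℕ} {x : ℝ} (hr : 0 < r) (h : FarFromEndpoints α r n x) :
    x ∈ I α :=
  h.mem_of_abs_sub_le (by rw [sub_self, abs_zero]; positivity)

theorem abs_div_abs_self {x : ℝ} (hx : x ≠ 0) : |(x / |x|)| = 1 := by
  rw [abs_div, abs_abs, div_self (abs_ne_zero.mpr hx)]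

/-- The tolerance `0.04` is `4 r` at the largest allowed `r = 0.01`. Since `1/|x| ≥ 1/G > 0.618`,
moving the image by that much keeps the denominator above `4/7`. -/
theorem branch_data (hα : α ∈ Icc g G) {x v : ℝ} (hx : x ∈ I α) (hx0 : x ≠ 0)
    (hv : |v - phiReal α x| ≤ 0.04) :
    ∃ k : ℕ, digit α x = 2 * k + 1 ∧ 4 / 7 ≤ 2 * k + 1 + v ∧
      |x / |x| / (digit α x + v)| = 1 / (2 * k + 1 + v) ∧ x / |x| / (digit α x + v) ≠ 0 := by
  obtain ⟨k, hk⟩ := exists_digit_eq hα hx hx0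
  have hk' : (digit α x : ℝ) = 2 * k + 1 := by rw [hk]; push_cast; ring
  have e := one_div_abs_eq (α := α) hx0
  have hG := abs_le_G_of_mem hα hx
  have hp : 0 < |x| := abs_pos.mpr hx0
  have := G_lt
  have h1 : 0.618 ≤ 1 / |x| := by
    rw [le_div_iff₀ hp]; nlinarith
  rw [hk'] at e
  rw [abs_le] at hv
  have h2 : 4 / 7 ≤ 2 * (k : ℝ) + 1 + v := by linarith
  have h3 : |x / |x| / (digit α x + v)| = 1 / (2 * k + 1 + v) := by
    rw [abs_div, abs_div_abs_self hx0, hk', abs_of_pos (by linarith)]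
  refine ⟨k, hk, h2, h3, ?_⟩
  rw [← abs_pos, h3]
  exact one_div_pos.mpr (by linarith)

theorem abs_branch_sub {ε d v v' : ℝ} (hε : |ε| = 1) (hv : d + v ≠ 0) (hv' : d + v' ≠ 0) :
    |ε / (d + v) - ε / (d + v')| = |ε / (d + v)| * |ε / (d + v')| * |v - v'| := by
  have hε2 : |ε| * |ε| = 1 := by rw [hε, one_mul]
  have : ε / (d + v) - ε / (d + v') = ε * (v' - v) / ((d + v) * (d + v')) := by
    field_simp; ring
  rw [this, abs_div, abs_mul, abs_mul, abs_div, abs_div, hε, abs_sub_comm v v']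
  ring

theorem psi_iterate {n : ℕ} {x : ℝ} (h : FarFromEndpoints α r n x) :
    psi α n x ((phiReal α)^[n] x) = x := by
  induction n generalizing x with
  | zero => rfl
  | succ n ih =>
    rw [Function.iterate_succ_apply, psi, ih h.tail, ← one_div_abs_eq h.ne_zero]
    have : |x| ≠ 0 := abs_ne_zero.mpr h.ne_zero
    field_simp

/-- The inverse branch is defined on the ball of radius `r` and contracts it exponentially. -/
def PsiSpec (α r : ℝ) (n : ℕ) : Prop :=
  ∀ x, FarFromEndpoints α r n x →
    (∀ w, |w - (phiReal α)^[n] x| ≤ r → psi α n x w ∈ I α ∧ (phiReal α)^[n] (psi α n x w) = w) ∧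
    (∀ w w', |w - (phiReal α)^[n] x| ≤ r → |w' - (phiReal α)^[n] x| ≤ r →
      |psi α n x w - psi α n x w'| ≤ 4 * (7 / 8) ^ n * |w - w'|)

theorem pow_mul_le (hr : 0 < r) (hr' : r ≤ 0.01) (n : ℕ) : 4 * (7 / 8 : ℝ) ^ n * r ≤ 0.04 := by
  have : (7 / 8 : ℝ) ^ n ≤ 1 := pow_le_one₀ (by norm_num) (by norm_num)
  nlinarith

theorem PsiSpec.abs_sub_le (hr : 0 < r) {n : ℕ} (hn : PsiSpec α r n) {x : ℝ}
    (h : FarFromEndpoints α r n x) {w : ℝ} (hw : |w - (phiReal α)^[n] x| ≤ r) :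
    |psi α n x w - x| ≤ 4 * (7 / 8) ^ n * r := by
  have := (hn x h).2 w _ hw (by rw [sub_self, abs_zero]; exact hr.le)
  rw [psi_iterate h] at this
  exact this.trans (by gcongr)

theorem PsiSpec.branch_data (hα : α ∈ Icc g G) (hr : 0 < r) (hr' : r ≤ 0.01) {n : ℕ}
    (hn : PsiSpec α r n) {x : ℝ} (h : FarFromEndpoints α r (n + 1) x) {w : ℝ}
    (hw : |w - (phiReal α)^[n + 1] x| ≤ r) :
    ∃ k : ℕ, digit α x = 2 * k + 1 ∧ 4 / 7 ≤ 2 * k + 1 + psi α n (phiReal α x) w ∧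
      |psi α (n + 1) x w| = 1 / (2 * k + 1 + psi α n (phiReal α x) w) ∧
      psi α (n + 1) x w ≠ 0 ∧ |psi α (n + 1) x w| ≤ 7 / 4 ∧
      |psi α (n + 1) x w| * |psi α n (phiReal α x) w| ≤ 7 / 8 := by
  have hI := ((hn _ h.tail).1 w hw).1
  obtain ⟨k, h1, h2, h3, h4⟩ := OddCF.branch_data hα (h.mem hr) h.ne_zero
    ((hn.abs_sub_le hr h.tail hw).trans (pow_mul_le hr hr' n))
  have := abs_branch_bounds hα hI h2
  refine ⟨k, h1, h2, h3, h4, ?_, ?_⟩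
  · rw [psi, h3]; exact this.1
  · rw [psi, h3]; exact this.2

theorem PsiSpec.abs_sub_eq (hα : α ∈ Icc g G) (hr : 0 < r) (hr' : r ≤ 0.01) {n : ℕ}
    (hn : PsiSpec α r n) {x : ℝ} (h : FarFromEndpoints α r (n + 1) x) {w w' : ℝ}
    (hw : |w - (phiReal α)^[n + 1] x| ≤ r) (hw' : |w' - (phiReal α)^[n + 1] x| ≤ r) :
    |psi α (n + 1) x w - psi α (n + 1) x w'| = |psi α (n + 1) x w| * |psi α (n + 1) x w'| *
      |psi α n (phiReal α x) w - psi α n (phiReal α x) w'| := by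
  obtain ⟨k, h1, h2, -⟩ := hn.branch_data hα hr hr' h hw
  obtain ⟨k', h1', h2', -⟩ := hn.branch_data hα hr hr' h hw'
  have e : (digit α x : ℝ) = 2 * k + 1 := by rw [h1]; push_cast; ring
  have e' : (digit α x : ℝ) = 2 * k' + 1 := by rw [h1']; push_cast; ring
  exact abs_branch_sub (abs_div_abs_self h.ne_zero) (by rw [e]; linarith) (by rw [e']; linarith)

/-- Contraction at stage `n+1` is left as a hypothesis: it needs stages `n` and `n-1` together,
whereas the other clause needs only stage `n`. -/
theorem PsiSpec.succ (hα : α ∈ Icc g G) (hr : 0 < r) (hr' : r ≤ 0.01) {n : ℕ}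
    (hn : PsiSpec α r n)
    (hc : ∀ x, FarFromEndpoints α r (n + 1) x → ∀ w w', |w - (phiReal α)^[n + 1] x| ≤ r →
      |w' - (phiReal α)^[n + 1] x| ≤ r →
      |psi α (n + 1) x w - psi α (n + 1) x w'| ≤ 4 * (7 / 8) ^ (n + 1) * |w - w'|) :
    PsiSpec α r (n + 1) := by
  intro x h
  refine ⟨fun w hw => ?_, hc x h⟩
  obtain ⟨k, h1, h2, h3, h4, -⟩ := hn.branch_data hα hr hr' h hw
  obtain ⟨hI, hf⟩ := (hn _ h.tail).1 w hw
  constructor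
  · apply h.mem_of_abs_sub_le
    have := hc x h w _ hw (by rw [sub_self, abs_zero]; exact hr.le)
    rw [psi_iterate h] at this
    exact this.trans (by gcongr)
  · rw [Function.iterate_succ_apply, phiReal_branch hI h4 h3, hf]

theorem psiSpec (hα : α ∈ Icc g G) (hr : 0 < r) (hr' : r ≤ 0.01) (n : ℕ) : PsiSpec α r n := by
  have h0 : PsiSpec α r 0 := by
    intro x h
    refine ⟨fun w hw => ⟨h.mem_of_abs_sub_le ?_, rfl⟩, fun w w' _ _ => ?_⟩
    · simp only [Function.iterate_zero, id] at hw
      simp only [psi, pow_zero]; linarith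
    · simp only [psi, pow_zero]
      linarith [abs_nonneg (w - w')]
  induction n using Nat.twoStepInduction with
  | zero => exact h0
  | one =>
    refine h0.succ hα hr hr' fun x h w w' hw hw' => ?_
    obtain ⟨-, -, -, -, -, h1, -⟩ := h0.branch_data hα hr hr' h hw
    obtain ⟨-, -, -, -, -, h1', -⟩ := h0.branch_data hα hr hr' h hw'
    rw [h0.abs_sub_eq hα hr hr' h hw hw']
    -- A single inverse step may expand, here by at most `49/16`; the constant `4` is there so that
    -- this is below `4 · 7/8`. Only pairs of steps contract, whence the two-step induction.
    have : |psi α (0 + 1) x w| * |psi α (0 + 1) x w'| ≤ 7 / 4 * (7 / 4) := by gcongr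
    have h2 := mul_le_mul_of_nonneg_right this (abs_nonneg (w - w'))
    simp only [psi] at h2 ⊢
    exact h2.trans (mul_le_mul_of_nonneg_right (by norm_num) (abs_nonneg _))
  | more n ih1 ih2 =>
    refine ih2.succ hα hr hr' fun x h w w' hw hw' => ?_
    obtain ⟨-, -, -, -, -, -, h1⟩ := ih2.branch_data hα hr hr' h hw
    obtain ⟨-, -, -, -, -, -, h1'⟩ := ih2.branch_data hα hr hr' h hw'
    rw [ih2.abs_sub_eq hα hr hr' h hw hw', ih1.abs_sub_eq hα hr hr' h.tail hw hw']
    have h2 := (ih1 _ h.tail.tail).2 w w' hw hw'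
    calc _ = (|psi α (n + 1 + 1) x w| * |psi α (n + 1) (phiReal α x) w|) *
          (|psi α (n + 1 + 1) x w'| * |psi α (n + 1) (phiReal α x) w'|) *
          |psi α n (phiReal α (phiReal α x)) w - psi α n (phiReal α (phiReal α x)) w'| := by ring
      _ ≤ (7 / 8) * (7 / 8) * (4 * (7 / 8) ^ n * |w - w'|) := by gcongr
      _ = _ := by ring

theorem hasDerivAt_psi (hα : α ∈ Icc g G) (hr : 0 < r) (hr' : r ≤ 0.01) (n : ℕ) {x : ℝ}
    (h : FarFromEndpoints α r n x) {w : ℝ} (hw : |w - (phiReal α)^[n] x| ≤ r) :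
    ∃ s, |s| = psiDeriv α n x w ∧ HasDerivAt (psi α n x) s w := by
  induction n generalizing x with
  | zero => exact ⟨1, abs_one, hasDerivAt_id w⟩
  | succ n ih =>
    obtain ⟨s, hs, hd⟩ := ih h.tail hw
    obtain ⟨k, h1, h2, h3, -⟩ := (psiSpec hα hr hr' n).branch_data hα hr hr' h hw
    have e : (digit α x : ℝ) = 2 * k + 1 := by rw [h1]; push_cast; ring
    have hne : (digit α x : ℝ) + psi α n (phiReal α x) w ≠ 0 := by rw [e]; linarith
    have := (hasDerivAt_const w (x / |x|)).div (hd.const_add (digit α x : ℝ)) hne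
    refine ⟨_, ?_, this⟩
    rw [psiDeriv, ← hs, ← sq_abs (psi α (n + 1) x w), psi, abs_div, abs_div,
      abs_div_abs_self h.ne_zero, zero_mul, zero_sub, abs_neg, abs_mul, abs_div_abs_self h.ne_zero,
      abs_pow]
    ring

theorem psiDeriv_pos (hα : α ∈ Icc g G) (hr : 0 < r) (hr' : r ≤ 0.01) (n : ℕ) {x : ℝ}
    (h : FarFromEndpoints α r n x) {w : ℝ} (hw : |w - (phiReal α)^[n] x| ≤ r) :
    0 < psiDeriv α n x w := by
  induction n generalizing x with
  | zero => exact one_pos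
  | succ n ih =>
    obtain ⟨k, -, -, -, h4, -⟩ := (psiSpec hα hr hr' n).branch_data hα hr hr' h hw
    have := ih h.tail hw
    rw [psiDeriv]
    positivity

theorem psiDeriv_le (hα : α ∈ Icc g G) (hr : 0 < r) (hr' : r ≤ 0.01) (n : ℕ) {x : ℝ}
    (h : FarFromEndpoints α r n x) {w : ℝ} (hw : |w - (phiReal α)^[n] x| ≤ r) :
    psiDeriv α n x w ≤ 4 * (7 / 8) ^ n := by
  induction n using Nat.twoStepInduction generalizing x with
  | zero => simp only [psiDeriv]; norm_num
  | one =>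
    obtain ⟨-, -, -, -, -, h1, -⟩ := (psiSpec hα hr hr' 0).branch_data hα hr hr' h hw
    have h2 := pow_le_pow_left₀ (abs_nonneg _) h1 2
    rw [sq_abs] at h2
    rw [psiDeriv, psiDeriv]
    norm_num at h2 ⊢
    linarith
  | more n ih1 _ =>
    obtain ⟨-, -, -, -, -, -, h1⟩ := (psiSpec hα hr hr' (n + 1)).branch_data hα hr hr' h hw
    have h2 := pow_le_pow_left₀ (by positivity) h1 2
    rw [mul_pow, sq_abs, sq_abs] at h2
    have h3 := ih1 h.tail.tail hw
    have h4 := psiDeriv_pos hα hr hr' n h.tail.tail hw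
    calc _ = psi α (n + 1 + 1) x w ^ 2 * psi α (n + 1) (phiReal α x) w ^ 2 *
        psiDeriv α n (phiReal α (phiReal α x)) w := by simp only [psiDeriv]; ring
      _ ≤ (7 / 8) ^ 2 * (4 * (7 / 8) ^ n) := by gcongr
      _ = _ := by ring

/-- Bounded distortion of the inverse branches. -/
theorem psiDeriv_distortion (hα : α ∈ Icc g G) (hr : 0 < r) (hr' : r ≤ 0.01) (n : ℕ) {x : ℝ}
    (h : FarFromEndpoints α r n x) {w w' : ℝ} (hw : |w - (phiReal α)^[n] x| ≤ r)
    (hw' : |w' - (phiReal α)^[n] x| ≤ r) :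
    psiDeriv α n x w ≤ Real.exp (224 * r * (1 - (7 / 8) ^ n)) * psiDeriv α n x w' := by
  induction n generalizing x with
  | zero => simp [psiDeriv]
  | succ n ih =>
    have hS := psiSpec hα hr hr' n
    obtain ⟨k, h1, h2, h3, h4, h5, h6⟩ := hS.branch_data hα hr hr' h hw
    obtain ⟨k', h1', h2', h3', h4', h5', h6'⟩ := hS.branch_data hα hr hr' h hw'
    obtain rfl : k = k' := by rw [h1] at h1'; exact_mod_cast (by linarith : (k : ℤ) = k')
    have hcon := (hS _ h.tail).2 w w' hw hw'
    have hww : |w - w'| ≤ 2 * r := by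
      have := abs_sub_le w ((phiReal α)^[n + 1] x) w'
      rw [abs_sub_comm ((phiReal α)^[n + 1] x) w'] at this
      linarith
    set v := psi α n (phiReal α x) w
    set v' := psi α n (phiReal α x) w'
    have hvv : |v - v'| ≤ 8 * (7 / 8) ^ n * r := by
      refine hcon.trans ?_
      calc _ ≤ 4 * (7 / 8) ^ n * (2 * r) := by gcongr
        _ = _ := by ring
    -- The quotient is `(2k+1+v')/(2k+1+v) ≤ 1 + (7/4)|v - v'|`, and `(7/4) · 8 = 14`. Squaring
    -- gives exponents `28 (7/8)^n r`, with geometric sum `224 r`.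
    have hz : |psi α (n + 1) x w| ≤ Real.exp (14 * (7 / 8) ^ n * r) * |psi α (n + 1) x w'| := by
      have hp : 0 < 2 * (k : ℝ) + 1 + v := by linarith
      have hp' : 0 < 2 * (k : ℝ) + 1 + v' := by linarith
      have h7 : 14 * (7 / 8) ^ n * r + 1 ≤ Real.exp (14 * (7 / 8) ^ n * r) :=
        Real.add_one_le_exp _
      rw [h3, h3', mul_one_div, div_le_div_iff₀ hp hp', one_mul]
      refine le_trans ?_ (mul_le_mul_of_nonneg_right h7 hp.le)
      have h8 : 0 ≤ 14 * (7 / 8 : ℝ) ^ n * r := by positivity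
      have h9 := mul_le_mul_of_nonneg_left h2 h8
      have := (abs_le.mp hvv).1
      linarith
    have hz2 := pow_le_pow_left₀ (abs_nonneg _) hz 2
    rw [mul_pow, sq_abs, sq_abs, ← Real.exp_nat_mul] at hz2
    have := psiDeriv_pos hα hr hr' n h.tail hw
    calc _ ≤ (Real.exp ((2 : ℕ) * (14 * (7 / 8) ^ n * r)) * psi α (n + 1) x w' ^ 2) *
          (Real.exp (224 * r * (1 - (7 / 8) ^ n)) * psiDeriv α n (phiReal α x) w') := by
          rw [psiDeriv]
          gcongr
          exact ih h.tail hw hw'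
      _ = (Real.exp ((2 : ℕ) * (14 * (7 / 8) ^ n * r)) *
          Real.exp (224 * r * (1 - (7 / 8) ^ n))) *
            (psi α (n + 1) x w' ^ 2 * psiDeriv α n (phiReal α x) w') := by ring
      _ = _ := by
          rw [← Real.exp_add, psiDeriv]
          congr 2
          push_cast; ring

/-! ### The density as a fixed point of the transfer operator -/

/-- The integral of `y ↦ (1 + x y)⁻²` over `[0, c]`. -/
noncomputable def mob (c x : ℝ) : ℝ := c / (1 + c * x)

open Classical in
/-- The unnormalized invariant density of `φ_α`. -/
noncomputable def dens (α x : ℝ) : ℝ :=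
  mob (2 - G) x + (if 1 / α - 1 < x then mob 1 x - mob (2 - G) x else 0) +
    (if 1 / (2 - α) - 1 ≤ x then mob G x - mob 1 x else 0)

theorem one_add_mul_pos_of_mem (hα : α ∈ Icc g G) {x : ℝ} (hx : x ∈ I α) :
    0.47 ≤ 1 + (2 - G) * x := by
  obtain ⟨h1, h2⟩ := bounds_of_mem hα
  have := G_gt
  have := G_lt
  have := G_sq
  have := hx.1
  nlinarith

theorem one_add_pos_of_lt (hα : α ∈ Icc g G) {x : ℝ} (hx : 1 / α - 1 < x) : 0.617 ≤ 1 + x := by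
  obtain ⟨h1, h2⟩ := bounds_of_mem hα
  have := G_gt
  have := G_lt
  have h : 0.617 ≤ 1 / α := by rw [le_div_iff₀ (by linarith)]; nlinarith
  linarith

theorem one_add_ge_of_le (hα : α ∈ Icc g G) {x : ℝ} (hx : 1 / (2 - α) - 1 ≤ x) :
    0.723 ≤ 1 + x := by
  obtain ⟨h1, h2⟩ := bounds_of_mem hα
  have := G_gt
  have := G_lt
  have h : 0.723 ≤ 1 / (2 - α) := by rw [le_div_iff₀ (by linarith)]; nlinarith
  linarith

theorem one_add_G_mul_pos_of_le (hα : α ∈ Icc g G) {x : ℝ} (hx : 1 / (2 - α) - 1 ≤ x) :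
    0.55 ≤ 1 + G * x := by
  have := one_add_ge_of_le hα hx
  have := G_gt
  have := G_lt
  nlinarith

theorem mob_sub {b c x : ℝ} (hb : 1 + b * x ≠ 0) (hc : 1 + c * x ≠ 0) :
    mob c x - mob b x = (c - b) / ((1 + b * x) * (1 + c * x)) := by
  unfold mob
  rw [div_sub_div _ _ hc hb, div_eq_div_iff (mul_ne_zero hc hb) (mul_ne_zero hb hc)]
  ring

theorem dens_parts (hα : α ∈ Icc g G) {x : ℝ} (hx : x ∈ I α) :
    (0 ≤ mob (2 - G) x ∧ mob (2 - G) x ≤ 1) ∧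
    (1 / α - 1 < x → 0 ≤ mob 1 x - mob (2 - G) x ∧ mob 1 x - mob (2 - G) x ≤ 3) ∧
    (1 / (2 - α) - 1 ≤ x → 0 ≤ mob G x - mob 1 x ∧ mob G x - mob 1 x ≤ 3) := by
  have h1 := one_add_mul_pos_of_mem hα hx
  have := G_gt
  have := G_lt
  refine ⟨⟨div_nonneg (by linarith) (by linarith), ?_⟩, fun h => ?_, fun h => ?_⟩
  · unfold mob
    rw [div_le_one (by linarith)]; linarith
  · have h2 := one_add_pos_of_lt hα h
    rw [mob_sub (by linarith) (by linarith)]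
    refine ⟨div_nonneg (by linarith) (mul_nonneg (by linarith) (by linarith)), ?_⟩
    have : 0.47 * 0.617 ≤ (1 + (2 - G) * x) * (1 + 1 * x) :=
      mul_le_mul h1 (by linarith) (by norm_num) (by linarith)
    rw [div_le_iff₀ (by linarith)]; linarith
  · have h2 := one_add_ge_of_le hα h
    have h3 := one_add_G_mul_pos_of_le hα h
    rw [mob_sub (by linarith) (by linarith)]
    refine ⟨div_nonneg (by linarith) (mul_nonneg (by linarith) (by linarith)), ?_⟩
    have : 0.723 * 0.55 ≤ (1 + 1 * x) * (1 + G * x) :=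
      mul_le_mul (by linarith) h3 (by norm_num) (by linarith)
    rw [div_le_iff₀ (by linarith)]; linarith

theorem dens_nonneg (hα : α ∈ Icc g G) {x : ℝ} (hx : x ∈ I α) : 0 ≤ dens α x := by
  obtain ⟨h1, h2, h3⟩ := dens_parts hα hx
  unfold dens
  refine add_nonneg (add_nonneg h1.1 ?_) ?_
  · split_ifs with h
    exacts [(h2 h).1, le_rfl]
  · split_ifs with h
    exacts [(h3 h).1, le_rfl]

theorem dens_le (hα : α ∈ Icc g G) {x : ℝ} (hx : x ∈ I α) : dens α x ≤ 7 := by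
  obtain ⟨h1, h2, h3⟩ := dens_parts hα hx
  have e2 : (if 1 / α - 1 < x then mob 1 x - mob (2 - G) x else 0) ≤ 3 := by
    split_ifs with h
    exacts [(h2 h).2, by norm_num]
  have e3 : (if 1 / (2 - α) - 1 ≤ x then mob G x - mob 1 x else 0) ≤ 3 := by
    split_ifs with h
    exacts [(h3 h).2, by norm_num]
  unfold dens
  linarith [h1.2]

theorem measurable_dens : Measurable (dens α) := by
  unfold dens mob
  refine Measurable.add (Measurable.add (by fun_prop) ?_) ?_
  · exact Measurable.ite measurableSet_Ioi (by fun_prop) measurable_const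
  · exact Measurable.ite measurableSet_Ici (by fun_prop) measurable_const

open Classical in
/-- The contribution of the branches `w ↦ ±1/(t+2j)`, `j ≥ 0`, to the transfer operator. -/
noncomputable def tail (α t : ℝ) : ℝ :=
  1 / (t - (2 - G)) + (if 1 / α - 1 < -1 / t then 1 / (t - 1) - 1 / (t - (2 - G)) else 0) +
    (if 1 / (2 - α) - 1 ≤ -1 / t then 1 / (t - G) - 1 / (t - 1) else 0)

theorem mob_inv_div {c t : ℝ} (ht : 0 < t) (hc : t + c ≠ 0) :
    mob c (1 / t) / t ^ 2 = 1 / t - 1 / (t + c) := by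
  unfold mob
  have : 1 + c * (1 / t) ≠ 0 := by
    have : 1 + c * (1 / t) = (t + c) / t := by field_simp
    rw [this]; positivity
  field_simp
  ring

theorem mob_neg_inv_div {c t : ℝ} (ht : 0 < t) (hc : t ≠ c) :
    mob c (-1 / t) / t ^ 2 = 1 / (t - c) - 1 / t := by
  unfold mob
  have h : t - c ≠ 0 := sub_ne_zero.mpr hc
  have : 1 + c * (-1 / t) = (t - c) / t := by field_simp; ring
  rw [this]
  field_simp
  ring

theorem dens_neg_inv {t : ℝ} (ht : 0 < t) (h1 : t ≠ 2 - G) (h2 : 1 / α - 1 < -1 / t → t ≠ 1)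
    (h3 : 1 / (2 - α) - 1 ≤ -1 / t → t ≠ G ∧ t ≠ 1) :
    dens α (-1 / t) / t ^ 2 = tail α t - 1 / t := by
  unfold dens tail
  rw [add_div, add_div, mob_neg_inv_div ht h1, ite_div, ite_div, sub_div, sub_div,
    mob_neg_inv_div ht h1]
  split_ifs with hA hB hB
  · rw [mob_neg_inv_div ht (h2 hA), mob_neg_inv_div ht (h3 hB).1]; ring
  · rw [mob_neg_inv_div ht (h2 hA)]; ring
  · rw [mob_neg_inv_div ht (h3 hB).1, mob_neg_inv_div ht (h3 hB).2]; ring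
  · ring

/-- Together with `le_inv_iff`: the strip of `Omega α` between heights `2 - G` and `1` is present
over `1/t` exactly when the strip between `1` and `G` is absent over `-1/(t+2)`, and vice versa. As
`c ↦ 2 - c` swaps these two strips, the pieces match up and the sum telescopes. -/
theorem lt_inv_iff (hα : α ∈ Icc g G) {t : ℝ} (ht : 0 < t) :
    1 / α - 1 < 1 / t ↔ ¬ (1 / (2 - α) - 1 ≤ -1 / (t + 2)) := by
  obtain ⟨h1, h2⟩ := bounds_of_mem hα
  have := G_gt
  have := G_lt
  have e1 : 1 / α - 1 = (1 - α) / α := by rw [sub_div, div_self (by linarith)]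
  have e2 : 1 / (2 - α) - 1 = (α - 1) / (2 - α) := by
    rw [eq_div_iff (by linarith), sub_mul, div_mul_cancel₀ _ (by linarith)]; ring
  rw [not_le, e1, e2, div_lt_div_iff₀ (by linarith) ht, div_lt_div_iff₀ (by linarith) (by linarith)]
  constructor <;> intro h <;> linarith

theorem le_inv_iff (hα : α ∈ Icc g G) {t : ℝ} (ht : 0 < t) :
    1 / (2 - α) - 1 ≤ 1 / t ↔ ¬ (1 / α - 1 < -1 / (t + 2)) := by
  obtain ⟨h1, h2⟩ := bounds_of_mem hα
  have := G_gt
  have := G_lt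
  have e1 : 1 / α - 1 = (1 - α) / α := by rw [sub_div, div_self (by linarith)]
  have e2 : 1 / (2 - α) - 1 = (α - 1) / (2 - α) := by
    rw [eq_div_iff (by linarith), sub_mul, div_mul_cancel₀ _ (by linarith)]; ring
  rw [not_lt, e1, e2, div_le_div_iff₀ (by linarith) ht, div_le_div_iff₀ (by linarith) (by linarith)]
  constructor <;> intro h <;> linarith

theorem dens_inv (hα : α ∈ Icc g G) {t : ℝ} (ht : 0 < t) :
    dens α (1 / t) / t ^ 2 = 1 / t - tail α (t + 2) := by
  have := G_gt
  have := G_lt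
  have ha : t + (2 - G) ≠ 0 := by linarith
  have h1 : t + 1 ≠ 0 := by linarith
  have hG : t + G ≠ 0 := by linarith
  unfold dens tail
  simp only [lt_inv_iff hα ht, le_inv_iff hα ht]
  rw [add_div, add_div, mob_inv_div ht ha, ite_div, ite_div, sub_div, sub_div,
    mob_inv_div ht ha, mob_inv_div ht h1, mob_inv_div ht hG,
    show t + 2 - (2 - G) = t + G by ring, show t + 2 - 1 = t + 1 by ring,
    show t + 2 - G = t + (2 - G) by ring]
  split_ifs <;> first | contradiction | ring

/-- The golden ratio enters here: `(2 - G)(1 + G) = 1` and `G(G - 1) = 1` rewrite the terms of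
`dens` as the simple fractions that the telescoping leaves. -/
theorem mob_eq_shift (x : ℝ) : mob (2 - G) x = 1 / (1 + x + G) ∧ mob 1 x = 1 / (1 + x) ∧
    mob G x = 1 / (1 + x - (2 - G)) := by
  have := G_gt
  have := G_lt
  have := G_sq
  refine ⟨?_, by rw [mob, one_mul], ?_⟩
  · have : 1 + (2 - G) * x = (2 - G) * (1 + x + G) := by linear_combination G_sq
    rw [mob, this, ← div_div, div_self (by linarith)]
  · have : 1 + G * x = G * (1 + x - (2 - G)) := by linear_combination -G_sq
    rw [mob, this, ← div_div, div_self (by linarith)]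

theorem tail_bounds {t : ℝ} (ht : G < t) : 0 ≤ tail α t ∧ tail α t ≤ 1 / (t - G) := by
  have := G_gt
  have := G_lt
  have h1 : 1 / (t - (2 - G)) ≤ 1 / (t - 1) :=
    one_div_le_one_div_of_le (by linarith) (by linarith)
  have h2 : 1 / (t - 1) ≤ 1 / (t - G) :=
    one_div_le_one_div_of_le (by linarith) (by linarith)
  have h3 : 0 ≤ 1 / (t - (2 - G)) := one_div_nonneg.mpr (by linarith)
  unfold tail
  split_ifs <;> constructor <;> linarith

/-- The points `w` for which `ε / (2k+1+w)` is a preimage of `w` in `I α`. -/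
def branchDom (α ε : ℝ) (k : ℕ) : Set ℝ :=
  {w | w ∈ I α ∧ 0 < 2 * k + 1 + w ∧ ε / (2 * k + 1 + w) ∈ I α}

theorem measurableSet_branchDom (ε : ℝ) (k : ℕ) : MeasurableSet (branchDom α ε k) := by
  have h : Measurable fun w : ℝ => 2 * (k : ℝ) + 1 + w := by fun_prop
  exact measurableSet_Ico.inter
    ((measurableSet_lt measurable_const h).inter ((h.const_div ε) measurableSet_Ico))

/-- Branches of digit at least `3` are full because `1/(2k+1+w) < 1/(1+α)`, while `1/(1+α) ≤ α` is
equivalent to `α ≥ g` and `1/(1+α) ≤ 2 - α` to `α ≤ G`. Both ends of the parameter range are thus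
sharp here. -/
theorem mem_branchDom_of_le (hα : α ∈ Icc g G) {ε w : ℝ} (hε : |ε| = 1)
    (hw : w ∈ Ioo (α - 2) α) {k : ℕ} (hk : 1 ≤ k) : w ∈ branchDom α ε k := by
  obtain ⟨h1, h2⟩ := bounds_of_mem hα
  have := G_gt
  have := G_lt
  have := G_sq
  obtain ⟨hw1, hw2⟩ := hw
  have hk' : (1 : ℝ) ≤ k := by exact_mod_cast hk
  have ht : 1 + α < 2 * k + 1 + w := by linarith
  have h3 : 1 / (2 * k + 1 + w) < α := by
    rw [div_lt_iff₀ (by linarith)]; nlinarith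
  have h4 : 1 / (2 * k + 1 + w) < 2 - α := by
    rw [div_lt_iff₀ (by linarith)]; nlinarith
  have h5 : 0 < 1 / (2 * k + 1 + w) := one_div_pos.mpr (by linarith)
  refine ⟨⟨hw1.le, hw2⟩, by linarith, ?_⟩
  rcases eq_or_eq_neg_of_abs_eq hε with rfl | rfl
  · constructor <;> linarith
  · rw [neg_div]; constructor <;> linarith

theorem mem_branchDom_zero_pos (hα : α ∈ Icc g G) {w : ℝ} (hw : w ∈ I α) :
    w ∈ branchDom α 1 0 ↔ 1 / α - 1 < w := by
  obtain ⟨h1, h2⟩ := bounds_of_mem hα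
  have := G_gt
  have := G_lt
  simp only [branchDom, mem_ofPred_eq, hw, true_and, Nat.cast_zero, mul_zero, zero_add]
  constructor
  · rintro ⟨h3, -, h4⟩
    have := (one_div_lt h3 (by linarith)).mp h4
    linarith
  · intro h
    have h0 : 0 < 1 + w := by linarith [one_add_pos_of_lt hα h]
    have h3 := (one_div_lt (by linarith : 0 < α) h0).mp (by linarith)
    have := one_div_pos.mpr h0
    exact ⟨h0, by linarith, h3⟩

theorem mem_branchDom_zero_neg (hα : α ∈ Icc g G) {w : ℝ} (hw : w ∈ I α) :
    w ∈ branchDom α (-1) 0 ↔ 1 / (2 - α) - 1 ≤ w := by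
  obtain ⟨h1, h2⟩ := bounds_of_mem hα
  have := G_gt
  have := G_lt
  simp only [branchDom, mem_ofPred_eq, hw, true_and, Nat.cast_zero, mul_zero, zero_add, neg_div]
  constructor
  · rintro ⟨h3, h4, -⟩
    have := (one_div_le h3 (by linarith : 0 < 2 - α)).mp (by linarith)
    linarith
  · intro h
    have h0 : 0 < 1 + w := by linarith [one_add_ge_of_le hα h]
    have h3 := (one_div_le (by linarith : 0 < 2 - α) h0).mp (by linarith)
    have := one_div_pos.mpr h0
    exact ⟨h0, by linarith, by linarith⟩

open Classical in
/-- One summand of the transfer operator applied to the invariant density. -/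
noncomputable def transferTerm (α ε : ℝ) (k : ℕ) (w : ℝ) : ℝ :=
  if w ∈ branchDom α ε k then dens α (ε / (2 * k + 1 + w)) / (2 * k + 1 + w) ^ 2 else 0

theorem transferTerm_nonneg (hα : α ∈ Icc g G) (ε : ℝ) (k : ℕ) (w : ℝ) :
    0 ≤ transferTerm α ε k w := by
  unfold transferTerm
  split_ifs with h
  · exact div_nonneg (dens_nonneg hα h.2.2) (sq_nonneg _)
  · exact le_rfl

/-- With `t = 2k+1+w`, the two signs contribute `1/t - tail (t+2)` and `tail t - 1/t`. -/
theorem transferTerm_add (hα : α ∈ Icc g G) {w : ℝ} (hw : w ∈ Ioo (α - 2) α) {k : ℕ}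
    (hk : 1 ≤ k) : transferTerm α 1 k w + transferTerm α (-1) k w =
      tail α (2 * k + 1 + w) - tail α (2 * k + 1 + w + 2) := by
  have hk' : (1 : ℝ) ≤ k := by exact_mod_cast hk
  obtain ⟨h1, h2⟩ := bounds_of_mem hα
  have := G_gt
  have ht : G < 2 * k + 1 + w := by linarith [hw.1]
  rw [transferTerm, transferTerm, if_pos (mem_branchDom_of_le hα (by simp) hw hk),
    if_pos (mem_branchDom_of_le hα (by simp) hw hk), dens_inv hα (by linarith),
    dens_neg_inv (by linarith) (by linarith) (fun _ => by linarith)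
      (fun _ => ⟨by linarith, by linarith⟩)]
  ring

theorem sq_le_of_mem (hα : α ∈ Icc g G) : α * α ≤ 1 + α := by
  obtain ⟨h1, h2⟩ := bounds_of_mem hα
  have := G_gt
  have := mul_nonneg (sub_nonneg.mpr h2) (by linarith : 0 ≤ α + G - 1)
  linarith [G_sq]

theorem transferTerm_zero_pos (hα : α ∈ Icc g G) {w : ℝ} (hw : w ∈ I α) :
    transferTerm α 1 0 w = if 1 / α - 1 < w then 1 / (1 + w) - tail α (3 + w) else 0 := by
  rw [transferTerm]
  simp only [mem_branchDom_zero_pos hα hw, Nat.cast_zero, mul_zero, zero_add]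
  refine if_ctx_congr Iff.rfl (fun h => ?_) fun _ => rfl
  have := one_add_pos_of_lt hα h
  rw [dens_inv hα (by linarith), show 1 + w + 2 = 3 + w by ring]

/-- Since `w < α`, the point `-1/(1+w)` lies to the left of both upper rectangles of `Omega α`, so
only the bottom strip contributes. -/
theorem transferTerm_zero_neg (hα : α ∈ Icc g G) {w : ℝ} (hw : w ∈ I α) :
    transferTerm α (-1) 0 w =
      if 1 / (2 - α) - 1 ≤ w then 1 / (1 + w - (2 - G)) - 1 / (1 + w) else 0 := by
  obtain ⟨h1, h2⟩ := bounds_of_mem hα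
  have := G_gt
  have := G_lt
  rw [transferTerm]
  simp only [mem_branchDom_zero_neg hα hw, Nat.cast_zero, mul_zero, zero_add]
  refine if_ctx_congr Iff.rfl (fun h => ?_) fun _ => rfl
  have h3 := one_add_ge_of_le hα h
  have hu : 1 / (1 + α) < 1 / (1 + w) :=
    one_div_lt_one_div_of_lt (by linarith) (by linarith [hw.2])
  have hA : ¬ (1 / α - 1 < -1 / (1 + w)) := by
    have : 1 ≤ 1 / α + 1 / (1 + α) := by
      rw [div_add_div _ _ (by linarith) (by linarith),
        le_div_iff₀ (mul_pos (by linarith) (by linarith))]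
      linarith [sq_le_of_mem hα]
    rw [neg_div]; linarith
  have hB : ¬ (1 / (2 - α) - 1 ≤ -1 / (1 + w)) := by
    have : 1 ≤ 1 / (2 - α) + 1 / (1 + α) := by
      rw [div_add_div _ _ (by linarith) (by linarith),
        le_div_iff₀ (mul_pos (by linarith) (by linarith))]
      linarith [sq_nonneg (α - 1 / 2)]
    rw [neg_div]; linarith
  rw [dens_neg_inv (by linarith) (by linarith) (fun h => absurd h hA) (fun h => absurd h hB),
    tail, if_neg hA, if_neg hB]
  ring

theorem tail_of_le (hα : α ∈ Icc g G) {w : ℝ} (hw : w ∈ I α) (h : w ≤ 1 / α - 1) :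
    tail α (3 + w) = 1 / (1 + w + G) := by
  obtain ⟨h1, h2⟩ := bounds_of_mem hα
  have := G_gt
  have := G_lt
  have hw3 : 0 < 3 + w := by linarith [hw.1]
  have h6 : 1 / (1 / α + 2) = α / (1 + 2 * α) := by
    have : α ≠ 0 := by linarith
    field_simp
  have h7 : 1 / (1 / α + 2) ≤ 1 / (3 + w) := one_div_le_one_div_of_le hw3 (by linarith)
  have hA : ¬ (1 / α - 1 < -1 / (3 + w)) := by
    rw [neg_div, not_lt]
    have h5 : 1 ≤ 1 / α + 1 / (1 / α + 2) := by
      rw [h6, div_add_div _ _ (by linarith) (by linarith),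
        le_div_iff₀ (mul_pos (by linarith) (by linarith))]
      linarith [sq_le_of_mem hα]
    linarith
  have hB : ¬ (1 / (2 - α) - 1 ≤ -1 / (3 + w)) := by
    rw [neg_div, not_le]
    -- At `α = g` the bound used in the other case becomes an equality. There `1/α - 1 = α`, and
    -- strictness comes from `w < α` instead.
    rcases eq_or_lt_of_le h1 with h' | h'
    · have hw2 := hw.2
      have : 1 / (2 + G) < 1 / (3 + w) := one_div_lt_one_div_of_lt hw3 (by linarith)
      have h5 : 1 ≤ 1 / (2 - α) + 1 / (2 + G) := by
        rw [← h', div_add_div _ _ (by linarith) (by linarith),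
          le_div_iff₀ (mul_pos (by linarith) (by linarith))]
        linarith [G_sq]
      linarith
    · have h5 : 1 < 1 / (2 - α) + 1 / (1 / α + 2) := by
        rw [h6, div_add_div _ _ (by linarith) (by linarith),
          lt_div_iff₀ (mul_pos (by linarith) (by linarith))]
        have := mul_pos (sub_pos.mpr h') (by linarith : 0 < α + G)
        linarith [G_sq]
      linarith
  rw [tail, if_neg hA, if_neg hB, show 3 + w - (2 - G) = 1 + w + G by ring]
  ring

/-- If the positive branch of digit `1` reaches `w`, its `-tail (3+w)` cancels the telescoped sum;
otherwise `tail (3+w)` is itself the bottom term `mob (2 - G) w`. -/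
theorem transferTerm_zero (hα : α ∈ Icc g G) {w : ℝ} (hw : w ∈ I α) :
    tail α (3 + w) + (transferTerm α 1 0 w + transferTerm α (-1) 0 w) = dens α w := by
  obtain ⟨e1, e2, e3⟩ := mob_eq_shift w
  rw [transferTerm_zero_pos hα hw, transferTerm_zero_neg hα hw, dens, e1, e2, e3]
  by_cases hA : 1 / α - 1 < w
  · rw [if_pos hA, if_pos hA]; ring
  · rw [if_neg hA, if_neg hA, tail_of_le hα hw (not_lt.mp hA)]; ring

theorem tendsto_tail (hα : α ∈ Icc g G) {w : ℝ} (hw : w ∈ Ioo (α - 2) α) :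
    Filter.Tendsto (fun n : ℕ => tail α (2 * n + 3 + w)) Filter.atTop (nhds 0) := by
  obtain ⟨hb1, hb2⟩ := bounds_of_mem hα
  have hG := G_gt
  have hlin : Filter.Tendsto (fun n : ℕ => 2 * (n : ℝ) + 3 + w - G) Filter.atTop
      Filter.atTop := by
    have := (tendsto_natCast_atTop_atTop (R := ℝ)).const_mul_atTop (by norm_num : (0 : ℝ) < 2)
    have := Filter.tendsto_atTop_add_const_right _ (3 + w - G) this
    exact this.congr fun n => by ring
  have ht : ∀ n : ℕ, G < 2 * n + 3 + w := fun n => by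
    have : (0 : ℝ) ≤ n := n.cast_nonneg
    linarith [hw.1]
  refine squeeze_zero (fun n => (tail_bounds (ht n)).1) (fun n => ?_) hlin.inv_tendsto_atTop
  have := (tail_bounds (α := α) (ht n)).2
  rwa [one_div] at this

theorem sum_transferTerm (hα : α ∈ Icc g G) {w : ℝ} (hw : w ∈ Ioo (α - 2) α) (n : ℕ) :
    ∑ k ∈ Finset.range n, (transferTerm α 1 (k + 1) w + transferTerm α (-1) (k + 1) w) =
      tail α (3 + w) - tail α (2 * n + 3 + w) := by
  induction n with
  | zero => simp
  | succ n ih =>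
    rw [Finset.sum_range_succ, ih, transferTerm_add hα hw (by omega)]
    push_cast
    rw [show 2 * ((n : ℝ) + 1) + 1 + w = 2 * n + 3 + w by ring,
      show 2 * ((n : ℝ) + 1) + 3 + w = 2 * n + 3 + w + 2 by ring]
    ring

/-- `dens α` is a fixed point of the transfer operator of `φ_α`. -/
theorem hasSum_transferTerm (hα : α ∈ Icc g G) {w : ℝ} (hw : w ∈ Ioo (α - 2) α) :
    HasSum (fun k => transferTerm α 1 k w + transferTerm α (-1) k w) (dens α w) := by
  have h1 : HasSum (fun k : ℕ => transferTerm α 1 (k + 1) w + transferTerm α (-1) (k + 1) w)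
      (tail α (3 + w)) := by
    rw [hasSum_iff_tendsto_nat_of_nonneg fun k =>
      add_nonneg (transferTerm_nonneg hα _ _ _) (transferTerm_nonneg hα _ _ _)]
    simp only [sum_transferTerm hα hw]
    have := (tendsto_tail hα hw).const_sub (tail α (3 + w))
    rwa [sub_zero] at this
  have h2 := (hasSum_nat_add_iff
    (f := fun k => transferTerm α 1 k w + transferTerm α (-1) k w) 1).mp h1
  rwa [Finset.sum_range_one, transferTerm_zero hα ⟨hw.1.le, hw.2⟩] at h2

/-! ### Invariance of the measure -/

/-- The unnormalized invariant measure of `φ_α`, on the real line. -/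
noncomputable def densMeasure (α : ℝ) : Measure ℝ :=
  (volume.restrict (I α)).withDensity fun x => ENNReal.ofReal (dens α x)

theorem densMeasure_apply {S : Set ℝ} (hS : MeasurableSet S) :
    densMeasure α S = ∫⁻ x in S ∩ I α, ENNReal.ofReal (dens α x) := by
  rw [densMeasure, withDensity_apply _ hS, Measure.restrict_restrict hS]

theorem densMeasure_le (hα : α ∈ Icc g G) {S : Set ℝ} (hS : MeasurableSet S) :
    densMeasure α S ≤ 7 * volume (S ∩ I α) := by
  rw [densMeasure_apply hS, ← setLIntegral_const]
  refine setLIntegral_mono measurable_const fun x hx => ?_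
  rw [← ENNReal.ofReal_ofNat]
  exact ENNReal.ofReal_le_ofReal (dens_le hα hx.2)

/-- The points of `I α` with sign `ε` and digit `2k+1` that are mapped into `E`. -/
def branchPreimage (α ε : ℝ) (k : ℕ) (E : Set ℝ) : Set ℝ :=
  {x | x ∈ I α ∧ 0 < ε * x ∧ digit α x = 2 * k + 1 ∧ phiReal α x ∈ E}

theorem measurableSet_branchPreimage (ε : ℝ) (k : ℕ) {E : Set ℝ} (hE : MeasurableSet E) :
    MeasurableSet (branchPreimage α ε k E) := by
  refine measurableSet_Ico.inter (MeasurableSet.inter ?_ (MeasurableSet.inter ?_ ?_))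
  · exact measurableSet_lt measurable_const (measurable_id.const_mul ε)
  · exact measurable_digit (measurableSet_singleton _)
  · exact measurable_phiReal hE

theorem image_branchDom (hα : α ∈ Icc g G) {ε : ℝ} (hε : |ε| = 1) (k : ℕ) (E : Set ℝ) :
    (fun w => ε / (2 * k + 1 + w)) '' (branchDom α ε k ∩ E) = branchPreimage α ε k E := by
  have hε2 : ε * ε = 1 := by rw [← abs_mul_abs_self, hε, one_mul]
  have hε0 : ε ≠ 0 := by rintro rfl; simp at hε
  ext x
  constructor
  · rintro ⟨w, ⟨⟨hw, ht, hx⟩, hE⟩, rfl⟩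
    have habs : |ε / (2 * k + 1 + w)| = 1 / (2 * k + 1 + w) := by
      rw [abs_div, hε, abs_of_pos ht]
    refine ⟨hx, ?_, digit_branch hw habs, ?_⟩
    · simp only
      rw [← mul_div_assoc, hε2]; exact one_div_pos.mpr ht
    · simp only
      rwa [phiReal_branch hw (div_ne_zero hε0 ht.ne') habs]
  · rintro ⟨hx, hpos, hd, hE⟩
    have hx0 : x ≠ 0 := by rintro rfl; simp at hpos
    have e := one_div_abs_eq (α := α) hx0
    rw [hd] at e
    push_cast at e
    have hxε : ε * |x| = x := by
      have : |x| = ε * x := by rw [← abs_of_pos hpos, abs_mul, hε, one_mul]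
      rw [this, ← mul_assoc, hε2, one_mul]
    have h2 : ε / (2 * k + 1 + phiReal α x) = x := by
      rw [← e, div_div_eq_mul_div, div_one, hxε]
    refine ⟨phiReal α x, ⟨⟨phiReal_mem hα hx, ?_, by rwa [h2]⟩, hE⟩, h2⟩
    rw [← e]; exact one_div_pos.mpr (abs_pos.mpr hx0)

theorem lintegral_branchPreimage (hα : α ∈ Icc g G) {ε : ℝ} (hε : |ε| = 1) (k : ℕ) {E : Set ℝ}
    (hE : MeasurableSet E) :
    ∫⁻ x in branchPreimage α ε k E, ENNReal.ofReal (dens α x) =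
      ∫⁻ w in E ∩ I α, ENNReal.ofReal (transferTerm α ε k w) := by
  have hε0 : ε ≠ 0 := by rintro rfl; simp at hε
  have hms := (measurableSet_branchDom (α := α) ε k).inter hE
  rw [← image_branchDom hα hε,
    lintegral_image_eq_lintegral_abs_deriv_mul hms
      (f' := fun w => -ε / (2 * k + 1 + w) ^ 2)]
  · have e1 : branchDom α ε k ∩ E = branchDom α ε k ∩ (E ∩ I α) := by
      ext w; constructor
      · exact fun h => ⟨h.1, h.2, h.1.1⟩
      · exact fun h => ⟨h.1, h.2.1⟩
    rw [e1, ← setLIntegral_indicator (measurableSet_branchDom ε k)]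
    refine lintegral_congr fun w => ?_
    by_cases hw : w ∈ branchDom α ε k
    · rw [indicator_of_mem hw, transferTerm, if_pos hw,
        ← ENNReal.ofReal_mul (abs_nonneg _), abs_div, abs_neg, hε, abs_pow, sq_abs]
      congr 1; ring
    · rw [indicator_of_notMem hw, transferTerm, if_neg hw, ENNReal.ofReal_zero]
  · intro w hw
    have ht := hw.1.2.1
    have := (hasDerivAt_const w ε).div ((hasDerivAt_id w).const_add (2 * (k : ℝ) + 1)) ht.ne'
    refine (this.congr_deriv ?_).hasDerivWithinAt
    simp
  · intro w hw w' hw' h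
    have ht := hw.1.2.1
    have ht' := hw'.1.2.1
    simp only at h
    rw [div_eq_div_iff ht.ne' ht'.ne'] at h
    have := mul_left_cancel₀ hε0 h
    linarith

theorem inter_phiReal_preimage (hα : α ∈ Icc g G) (E : Set ℝ) :
    (phiReal α ⁻¹' E ∩ I α) \ {0} =
      (⋃ k, branchPreimage α 1 k E) ∪ ⋃ k, branchPreimage α (-1) k E := by
  ext x
  simp only [mem_sdiff, mem_inter_iff, mem_preimage, mem_singleton_iff, mem_union, mem_iUnion,
    branchPreimage, mem_ofPred_eq]
  constructor
  · rintro ⟨⟨hE, hx⟩, hx0⟩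
    obtain ⟨k, hk⟩ := exists_digit_eq hα hx hx0
    rcases lt_or_gt_of_ne hx0 with h | h
    · exact Or.inr ⟨k, hx, by linarith, hk, hE⟩
    · exact Or.inl ⟨k, hx, by linarith, hk, hE⟩
  · rintro (⟨k, hx, h, -, hE⟩ | ⟨k, hx, h, -, hE⟩) <;>
      exact ⟨⟨hE, hx⟩, by rintro rfl; simp at h⟩

theorem lintegral_iUnion_branchPreimage (ε : ℝ) {E : Set ℝ} (hE : MeasurableSet E)
    (F : ℝ → ENNReal) :
    ∫⁻ x in ⋃ k, branchPreimage α ε k E, F x = ∑' k, ∫⁻ x in branchPreimage α ε k E, F x := by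
  refine lintegral_iUnion (fun k => measurableSet_branchPreimage ε k hE) (fun i j hij => ?_) F
  refine Set.disjoint_left.mpr fun x hx hx' => hij ?_
  have := hx.2.2.1.symm.trans hx'.2.2.1
  exact_mod_cast (by linarith : (i : ℤ) = j)

theorem measurable_transferTerm (ε : ℝ) (k : ℕ) : Measurable (transferTerm α ε k) := by
  have h : Measurable fun w : ℝ => 2 * (k : ℝ) + 1 + w := by fun_prop
  exact Measurable.ite (measurableSet_branchDom ε k)
    ((measurable_dens.comp (h.const_div ε)).div (h.pow_const 2)) measurable_const

/-- Up to the null point `0`, the preimage is a disjoint union of branch pieces. Change of variables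
turns each piece into a `transferTerm`, and the fixed-point equation sums them. -/
theorem densMeasure_preimage (hα : α ∈ Icc g G) {E : Set ℝ} (hE : MeasurableSet E) :
    densMeasure α (phiReal α ⁻¹' E) = densMeasure α E := by
  have hd : Disjoint (⋃ k, branchPreimage α 1 k E) (⋃ k, branchPreimage α (-1) k E) := by
    simp only [disjoint_iUnion_left, disjoint_iUnion_right]
    intro i j
    refine Set.disjoint_left.mpr fun x hx hx' => ?_
    have h1 := hx.2.1
    have h2 := hx'.2.1
    linarith
  rw [densMeasure_apply (measurable_phiReal hE), densMeasure_apply hE,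
    ← setLIntegral_congr (sdiff_null_ae_eq_self (measure_singleton (0 : ℝ))),
    inter_phiReal_preimage hα, lintegral_union
      (MeasurableSet.iUnion fun k => measurableSet_branchPreimage _ k hE) hd,
    lintegral_iUnion_branchPreimage 1 hE, lintegral_iUnion_branchPreimage (-1) hE,
    ← ENNReal.tsum_add]
  simp only [lintegral_branchPreimage hα (abs_one : |(1 : ℝ)| = 1) _ hE,
    lintegral_branchPreimage hα (by simp : |(-1 : ℝ)| = 1) _ hE]
  have hm : ∀ ε k, Measurable fun w => ENNReal.ofReal (transferTerm α ε k w) := fun ε k =>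
    (measurable_transferTerm ε k).ennreal_ofReal
  simp only [← lintegral_add_left (hm 1 _)]
  rw [← lintegral_tsum (f := fun k w => ENNReal.ofReal (transferTerm α 1 k w) +
    ENNReal.ofReal (transferTerm α (-1) k w)) fun k => ((hm 1 k).add (hm (-1) k)).aemeasurable]
  -- The fixed-point equation is available only on the open interval, so the left endpoint is
  -- discarded.
  have hne : ∀ᵐ w : ℝ, w ≠ α - 2 := Measure.ae_ne volume _
  refine lintegral_congr_ae ?_
  filter_upwards [ae_restrict_of_ae hne, ae_restrict_mem (hE.inter measurableSet_I)] with w h1 h2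
  have hs := hasSum_transferTerm hα ⟨lt_of_le_of_ne h2.2.1 (Ne.symm h1), h2.2.2⟩
  simp only [← ENNReal.ofReal_add (transferTerm_nonneg hα _ _ _) (transferTerm_nonneg hα _ _ _)]
  rw [← ENNReal.ofReal_tsum_of_nonneg (fun k =>
    add_nonneg (transferTerm_nonneg hα _ _ _) (transferTerm_nonneg hα _ _ _)) hs.summable,
    hs.tsum_eq]

theorem measurePreserving_phiReal (hα : α ∈ Icc g G) :
    MeasurePreserving (phiReal α) (densMeasure α) (densMeasure α) :=
  ⟨measurable_phiReal, Measure.ext fun E hE => by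
    rw [Measure.map_apply measurable_phiReal hE, densMeasure_preimage hα hE]⟩

/-! ### Projection of the planar measure and its total mass -/

theorem one_add_mul_pos_of_between {b c t x : ℝ} (hb : 0 < 1 + b * x) (hc : 0 < 1 + c * x)
    (ht : t ∈ Icc b c) : 0 < 1 + t * x := by
  rcases le_total 0 x with h | h
  · nlinarith [ht.1]
  · nlinarith [ht.2]

theorem lintegral_inv_sq {b c x : ℝ} (hbc : b ≤ c) (hb : 0 < 1 + b * x) (hc : 0 < 1 + c * x) :
    ∫⁻ y in Ioc b c, ENNReal.ofReal (((1 + x * y) ^ 2)⁻¹) =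
      ENNReal.ofReal (mob c x - mob b x) := by
  have hpos : ∀ y ∈ uIcc b c, 0 < 1 + x * y := fun y hy => by
    rw [uIcc_of_le hbc] at hy
    rw [mul_comm]; exact one_add_mul_pos_of_between hb hc hy
  have hcont : ContinuousOn (fun y => ((1 + x * y) ^ 2)⁻¹) (uIcc b c) := by
    refine ContinuousOn.inv₀ (by fun_prop) fun y hy => (pow_pos (hpos y hy) 2).ne'
  have hint : IntervalIntegrable (fun y => ((1 + x * y) ^ 2)⁻¹) volume b c :=
    hcont.intervalIntegrable
  rw [← ofReal_integral_eq_lintegral_ofReal hint.1 (ae_of_all _ fun y => by positivity),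
    ← intervalIntegral.integral_of_le hbc]
  congr 1
  refine intervalIntegral.integral_eq_sub_of_hasDerivAt (f := fun y => mob y x) (fun y hy => ?_) hint
  have h := hpos y hy
  have hne : 1 + y * x ≠ 0 := by rw [mul_comm]; exact h.ne'
  have := (hasDerivAt_id y).div (((hasDerivAt_id y).mul_const x).const_add 1) hne
  refine this.congr_deriv ?_
  simp only [id]
  field_simp
  ring

theorem lintegral_mob_sub {b c p q : ℝ} (hpq : p ≤ q) (hbc : b ≤ c)
    (hb : ∀ x ∈ Icc p q, 0 < 1 + b * x) (hc : ∀ x ∈ Icc p q, 0 < 1 + c * x) :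
    0 ≤ (Real.log (1 + c * q) - Real.log (1 + b * q)) -
        (Real.log (1 + c * p) - Real.log (1 + b * p)) ∧
    ∫⁻ x in Ioc p q, ENNReal.ofReal (mob c x - mob b x) =
      ENNReal.ofReal ((Real.log (1 + c * q) - Real.log (1 + b * q)) -
        (Real.log (1 + c * p) - Real.log (1 + b * p))) := by
  have hcont : ContinuousOn (fun x => mob c x - mob b x) (uIcc p q) := by
    rw [uIcc_of_le hpq]
    unfold mob
    exact (continuousOn_const.div (by fun_prop) fun x hx => (hc x hx).ne').sub
      (continuousOn_const.div (by fun_prop) fun x hx => (hb x hx).ne')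
  have hint : IntervalIntegrable (fun x => mob c x - mob b x) volume p q :=
    hcont.intervalIntegrable
  have hnn : 0 ≤ᵐ[volume.restrict (Ioc p q)] fun x => mob c x - mob b x := by
    filter_upwards [ae_restrict_mem measurableSet_Ioc] with x hx
    have h1 := hb x (Ioc_subset_Icc_self hx)
    have h2 := hc x (Ioc_subset_Icc_self hx)
    rw [Pi.zero_apply, mob_sub h1.ne' h2.ne']
    exact div_nonneg (sub_nonneg.mpr hbc) (mul_pos h1 h2).le
  have heq := intervalIntegral.integral_eq_sub_of_hasDerivAt
    (f := fun x => Real.log (1 + c * x) - Real.log (1 + b * x)) (fun x hx => by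
      rw [uIcc_of_le hpq] at hx
      have h1 := (((hasDerivAt_id x).const_mul c).const_add 1).log (hc x hx).ne'
      have h2 := (((hasDerivAt_id x).const_mul b).const_add 1).log (hb x hx).ne'
      exact (h1.sub h2).congr_deriv (by simp [mob])) hint
  rw [← ofReal_integral_eq_lintegral_ofReal hint.1 hnn, ← heq,
    intervalIntegral.integral_of_le hpq]
  exact ⟨integral_nonneg_of_ae hnn, rfl⟩

theorem left_endpoints (hα : α ∈ Icc g G) :
    α - 2 ≤ 1 / α - 1 ∧ 1 / α - 1 ≤ α ∧ α - 2 ≤ 1 / (2 - α) - 1 ∧ 1 / (2 - α) - 1 ≤ α := by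
  obtain ⟨h1, h2⟩ := bounds_of_mem hα
  have := G_gt
  have := G_lt
  have := sq_le_of_mem hα
  have hα0 : 0 < α := by linarith
  have hα2 : 0 < 2 - α := by linarith
  have e1 : α - 1 ≤ 1 / α := by rw [le_div_iff₀ hα0]; nlinarith
  have e2 : 1 / α ≤ α + 1 := by
    rw [div_le_iff₀ hα0]
    have := mul_nonneg (sub_nonneg.mpr h1) (by linarith : 0 ≤ α + G)
    linarith [G_sq]
  have e3 : 0 < 1 / (2 - α) := one_div_pos.mpr hα2
  have e3' : α - 1 ≤ 1 / (2 - α) := by rw [le_div_iff₀ hα2]; nlinarith [sq_nonneg (α - 3 / 2)]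
  have e4 : 1 / (2 - α) ≤ α + 1 := by rw [div_le_iff₀ hα2]; nlinarith
  refine ⟨?_, ?_, ?_, ?_⟩ <;> linarith

/-- The zero term `mob 0` gives all three strips the common form `mob c - mob b`, matching a
rectangle with `y` between `b` and `c`. -/
theorem densMeasure_eq_add (hα : α ∈ Icc g G) {S : Set ℝ} (hS : MeasurableSet S) :
    densMeasure α S = (∫⁻ x in S ∩ I α, ENNReal.ofReal (mob (2 - G) x - mob 0 x)) +
      (∫⁻ x in S ∩ Ioo (1 / α - 1) α, ENNReal.ofReal (mob 1 x - mob (2 - G) x)) +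
      ∫⁻ x in S ∩ Ico (1 / (2 - α) - 1) α, ENNReal.ofReal (mob G x - mob 1 x) := by
  obtain ⟨h1, -, h2, -⟩ := left_endpoints hα
  have hmob : ∀ c, Measurable (mob c) := fun c => by unfold mob; fun_prop
  have e1 : S ∩ Ioo (1 / α - 1) α = Ioi (1 / α - 1) ∩ (S ∩ I α) := by
    ext x; constructor
    · exact fun h => ⟨h.2.1, h.1, h1.trans h.2.1.le, h.2.2⟩
    · exact fun h => ⟨h.2.1, h.1, h.2.2.2⟩
  have e2 : S ∩ Ico (1 / (2 - α) - 1) α = Ici (1 / (2 - α) - 1) ∩ (S ∩ I α) := by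
    ext x; constructor
    · exact fun h => ⟨h.2.1, h.1, h2.trans h.2.1, h.2.2⟩
    · exact fun h => ⟨h.2.1, h.1, h.2.2.2⟩
  rw [e1, e2, ← setLIntegral_indicator measurableSet_Ioi, ← setLIntegral_indicator measurableSet_Ici,
    ← lintegral_add_left (f := fun x => ENNReal.ofReal (mob (2 - G) x - mob 0 x))
      ((hmob _).sub (hmob _)).ennreal_ofReal, ← lintegral_add_left,
    densMeasure_apply hS]
  · refine setLIntegral_congr_fun (hS.inter measurableSet_I) fun x hx => ?_
    obtain ⟨p1, p2, p3⟩ := dens_parts hα hx.2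
    have e0 : mob 0 x = 0 := by simp [mob]
    simp only [Set.indicator, mem_Ioi, mem_Ici, dens, e0, sub_zero]
    split_ifs with hA hB hB
    · rw [ENNReal.ofReal_add (add_nonneg p1.1 (p2 hA).1) (p3 hB).1,
        ENNReal.ofReal_add p1.1 (p2 hA).1]
    · rw [add_zero, add_zero, ENNReal.ofReal_add p1.1 (p2 hA).1]
    · rw [add_zero, add_zero, ENNReal.ofReal_add p1.1 (p3 hB).1]
    · simp
  · exact (((hmob _).sub (hmob _)).ennreal_ofReal).add
      ((((hmob _).sub (hmob _)).ennreal_ofReal).indicator measurableSet_Ioi)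

theorem lintegral_rectangle {J K S : Set ℝ} (hJ : MeasurableSet J) (hS : MeasurableSet S)
    {b c : ℝ} (hK : K =ᵐ[volume] Ioc b c) (hbc : b ≤ c)
    (hb : ∀ x ∈ J, 0 < 1 + b * x) (hc : ∀ x ∈ J, 0 < 1 + c * x) :
    ∫⁻ p in (S ∩ J) ×ˢ K, ENNReal.ofReal (((1 + p.1 * p.2) ^ 2)⁻¹) =
      ∫⁻ x in S ∩ J, ENNReal.ofReal (mob c x - mob b x) := by
  rw [Measure.volume_eq_prod, ← Measure.prod_restrict, lintegral_prod _ (by fun_prop)]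
  refine setLIntegral_congr_fun (hS.inter hJ) fun x hx => ?_
  simp only
  rw [Measure.restrict_congr_set hK, lintegral_inv_sq hbc (hb x hx.2) (hc x hx.2)]

/-- Fubini on each rectangle. The second and third rectangles may overlap on the line `y = 1`, so
they are disjoint only up to a null set. -/
theorem map_fst_mu (hα : α ∈ Icc g G) : (mu α).map Prod.fst = densMeasure α := by
  have hG := G_gt
  have hG' := G_lt
  refine Measure.ext fun S hS => ?_
  have hm1 : MeasurableSet (I α ×ˢ Ico 0 (2 - G)) := measurableSet_I.prod measurableSet_Ico
  have hm2 : MeasurableSet (Ioo (1 / α - 1) α ×ˢ Ioc (2 - G) 1) :=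
    measurableSet_Ioo.prod measurableSet_Ioc
  have hm3 : MeasurableSet (Ico (1 / (2 - α) - 1) α ×ˢ Ico 1 G) :=
    measurableSet_Ico.prod measurableSet_Ico
  have hfst : MeasurableSet (Prod.fst ⁻¹' S : Set (ℝ × ℝ)) := measurable_fst hS
  have hpre : ∀ J K : Set ℝ, Prod.fst ⁻¹' S ∩ J ×ˢ K = (S ∩ J) ×ˢ K := fun J K => by
    ext p; simp [and_assoc]
  have hd12 : Disjoint ((S ∩ I α) ×ˢ Ico 0 (2 - G)) ((S ∩ Ioo (1 / α - 1) α) ×ˢ Ioc (2 - G) 1) :=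
    Set.disjoint_left.mpr fun p h h' => absurd h'.2.1 (not_lt.mpr h.2.2.le)
  rw [Measure.map_apply measurable_fst hS, mu, withDensity_apply _ hfst,
    Measure.restrict_restrict hfst, Omega, inter_union_distrib_left, inter_union_distrib_left,
    hpre, hpre, hpre]
  have hpos : ∀ x ∈ Ioo (1 / α - 1) α, 0 < 1 + (2 - G) * x := fun x hx => by
    have h1 := (left_endpoints hα).1
    linarith [one_add_mul_pos_of_mem hα (⟨by linarith [hx.1], hx.2⟩ : x ∈ I α)]
  have hae : Ico (1 : ℝ) G =ᵐ[volume] Ioc 1 G := Ico_ae_eq_Ioc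
  have hd3 : AEDisjoint volume ((S ∩ I α) ×ˢ Ico 0 (2 - G) ∪
      (S ∩ Ioo (1 / α - 1) α) ×ˢ Ioc (2 - G) 1) ((S ∩ Ico (1 / (2 - α) - 1) α) ×ˢ Ico 1 G) := by
    have hz : volume ((univ : Set ℝ) ×ˢ ({1} : Set ℝ)) = 0 := by
      rw [Measure.volume_eq_prod, Measure.prod_prod, measure_singleton, mul_zero]
    refine measure_mono_null (fun p hp => ?_) hz
    refine ⟨mem_univ _, ?_⟩
    obtain ⟨h | h, h'⟩ := hp
    · exact absurd h'.2.1 (not_le.mpr (by linarith [h.2.2]))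
    · exact le_antisymm h.2.2 h'.2.1
  have hm3' : MeasurableSet ((S ∩ Ico (1 / (2 - α) - 1) α) ×ˢ Ico 1 G) := by
    rw [← hpre]; exact hfst.inter hm3
  have hm2' : MeasurableSet ((S ∩ Ioo (1 / α - 1) α) ×ˢ Ioc (2 - G) 1) := by
    rw [← hpre]; exact hfst.inter hm2
  rw [Measure.restrict_union₀ hd3 hm3'.nullMeasurableSet, lintegral_add_measure,
    lintegral_union hm2' hd12,
    lintegral_rectangle (b := 0) measurableSet_I hS Ico_ae_eq_Ioc (by linarith)
      (fun x _ => by simp) (fun x hx => by linarith [one_add_mul_pos_of_mem hα hx]),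
    lintegral_rectangle measurableSet_Ioo hS Filter.EventuallyEq.rfl (by linarith)
      hpos (fun x hx => by linarith [one_add_pos_of_lt hα hx.1]),
    lintegral_rectangle measurableSet_Ico hS hae (by linarith)
      (fun x hx => by linarith [one_add_ge_of_le hα hx.1])
      (fun x hx => by linarith [one_add_G_mul_pos_of_le hα hx.1]),
    densMeasure_eq_add hα hS]

/-- By `G² = G + 1`, each argument other than those cancelling at once factors through `α`, `2 - α`,
`α + G - 1` and constants. The dependence on `α` cancels, leaving `log G - log (2 - G)` with `2 - G
= G⁻²`. -/
theorem log_mass_identity (hα : α ∈ Icc g G) :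
    (Real.log (1 + (2 - G) * α) - Real.log (1 + (2 - G) * (α - 2))) +
      ((Real.log (1 + 1 * α) - Real.log (1 + (2 - G) * α)) -
        (Real.log (1 + 1 * (1 / α - 1)) - Real.log (1 + (2 - G) * (1 / α - 1)))) +
      ((Real.log (1 + G * α) - Real.log (1 + 1 * α)) -
        (Real.log (1 + G * (1 / (2 - α) - 1)) - Real.log (1 + 1 * (1 / (2 - α) - 1)))) =
      3 * Real.log G := by
  obtain ⟨h1, h2⟩ := bounds_of_mem hα
  have hG := G_gt
  have hG' := G_lt
  have hsq := G_sq
  have a0 : 0 < α := by linarith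
  have a2 : 0 < 2 - α := by linarith
  have b0 : α + (G - 1) ≠ 0 := by linarith
  have e1 : 1 + (2 - G) * (α - 2) = (2 - G) * (α + (G - 1)) := by linear_combination hsq
  have e2 : 1 + 1 * (1 / α - 1) = α⁻¹ := by rw [one_div]; ring
  have e3 : 1 + 1 * (1 / (2 - α) - 1) = (2 - α)⁻¹ := by rw [one_div]; ring
  have e4 : 1 + (2 - G) * (1 / α - 1) = (G - 1) * (α + (G - 1)) * α⁻¹ := by
    field_simp; linear_combination -hsq
  have e5 : 1 + G * (1 / (2 - α) - 1) = (G - 1) * (α + (G - 1)) * (2 - α)⁻¹ := by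
    field_simp; linear_combination -hsq
  have e6 : 1 + G * α = G * (α + (G - 1)) := by linear_combination -hsq
  have e7 : 2 - G = (G ^ 2)⁻¹ := by
    refine eq_inv_of_mul_eq_one_left ?_
    rw [hsq]; linear_combination -hsq
  rw [e1, e2, e3, e4, e5, e6, Real.log_mul (by linarith) b0, Real.log_inv, Real.log_inv,
    Real.log_mul (mul_ne_zero (by linarith) b0) (inv_ne_zero a0.ne'),
    Real.log_mul (mul_ne_zero (by linarith) b0) (inv_ne_zero a2.ne'),
    Real.log_mul (by linarith) b0, Real.log_mul (by linarith) b0, Real.log_inv, Real.log_inv]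
  have e8 : Real.log (2 - G) = -(2 * Real.log G) := by
    rw [e7, Real.log_inv, Real.log_pow]; norm_num
  rw [e8]; ring

theorem densMeasure_univ (hα : α ∈ Icc g G) :
    densMeasure α univ = ENNReal.ofReal (3 * Real.log G) := by
  have hG := G_gt
  have hG' := G_lt
  obtain ⟨h1, h2, h3, h4⟩ := left_endpoints hα
  have hc1 : ∀ x ∈ Icc (1 / α - 1) α, 0 < 1 + 1 * x := fun x hx => by
    obtain ⟨hb1, hb2⟩ := bounds_of_mem hα
    have : 0 < 1 / α := one_div_pos.mpr (by linarith)
    linarith [hx.1]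
  have hca : ∀ x ∈ Icc (α - 2) α, 0 < 1 + (2 - G) * x := fun x hx => by
    have := one_add_mul_pos_of_mem hα (⟨le_rfl, by linarith⟩ : α - 2 ∈ I α)
    nlinarith [hx.1]
  obtain ⟨n1, m1⟩ := lintegral_mob_sub (p := α - 2) (q := α) (b := 0) (by linarith)
    (by linarith) (fun x _ => by simp) hca
  obtain ⟨n2, m2⟩ := lintegral_mob_sub h2 (by linarith)
    (fun x hx => hca x ⟨h1.trans hx.1, hx.2⟩) hc1
  obtain ⟨n3, m3⟩ := lintegral_mob_sub (b := 1) (c := G) h4 (by linarith)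
    (fun x hx => by linarith [one_add_ge_of_le hα hx.1])
    (fun x hx => by linarith [one_add_G_mul_pos_of_le hα hx.1])
  rw [densMeasure_eq_add hα MeasurableSet.univ, univ_inter, univ_inter, univ_inter,
    I, setLIntegral_congr Ico_ae_eq_Ioc, setLIntegral_congr Ioo_ae_eq_Ioc,
    setLIntegral_congr Ico_ae_eq_Ioc, m1, m2, m3,
    ← ENNReal.ofReal_add n1 n2, ← ENNReal.ofReal_add (add_nonneg n1 n2) n3,
    ← log_mass_identity hα]
  congr 1; simp

theorem log_G_pos : 0 < Real.log G := Real.log_pos (by linarith [G_gt])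

/-- The normalized invariant measure of `φ_α`, on the real line. -/
noncomputable def realNu (α : ℝ) : Measure ℝ :=
  ENNReal.ofReal ((3 * Real.log G)⁻¹) • densMeasure α

theorem nu_eq_comap (hα : α ∈ Icc g G) : nu α = (realNu α).comap Subtype.val := by
  rw [nu, muTilde, Measure.map_smul, map_fst_mu hα, realNu]

theorem isProbabilityMeasure_realNu (hα : α ∈ Icc g G) : IsProbabilityMeasure (realNu α) := by
  refine ⟨?_⟩
  have := log_G_pos
  rw [realNu, Measure.smul_apply, densMeasure_univ hα, smul_eq_mul,
    ← ENNReal.ofReal_mul (by positivity), inv_mul_cancel₀ (by positivity), ENNReal.ofReal_one]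

theorem realNu_compl_I : realNu α (I α)ᶜ = 0 := by
  rw [realNu, Measure.smul_apply, densMeasure_apply measurableSet_I.compl, compl_inter_self,
    Measure.restrict_empty, lintegral_zero_measure, smul_zero]

theorem realNu_absolutelyContinuous : realNu α ≪ volume :=
  Measure.AbsolutelyContinuous.trans Measure.smul_absolutelyContinuous
    ((withDensity_absolutelyContinuous _ _).trans Measure.restrict_le_self.absolutelyContinuous)

theorem measurePreserving_realNu (hα : α ∈ Icc g G) :
    MeasurePreserving (phiReal α) (realNu α) (realNu α) :=
  ⟨measurable_phiReal, by rw [realNu, Measure.map_smul, (measurePreserving_phiReal hα).map_eq]⟩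

/-- Normalization only decreases the measure, because `log G ≥ 1 - 1/G ≥ 0.34` gives `3 log G ≥ 1`.
-/
theorem realNu_le (hα : α ∈ Icc g G) {S : Set ℝ} (hS : MeasurableSet S) :
    realNu α S ≤ 7 * volume (S ∩ I α) := by
  have hlog : 1 ≤ 3 * Real.log G := by
    have h : Real.log (G⁻¹) ≤ G⁻¹ - 1 := Real.log_le_sub_one_of_pos (by have := G_gt; positivity)
    rw [Real.log_inv] at h
    have : G⁻¹ ≤ 0.66 := by
      rw [inv_le_comm₀ (by linarith [G_gt]) (by norm_num)]; norm_num; linarith [G_gt]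
    linarith
  rw [realNu, Measure.smul_apply, smul_eq_mul]
  refine le_trans (mul_le_of_le_one_left zero_le ?_) (densMeasure_le hα hS)
  rw [ENNReal.ofReal_le_one]
  exact inv_le_one_of_one_le₀ hlog

theorem nu_apply (hα : α ∈ Icc g G) (E : Set (I α)) : nu α E = realNu α (Subtype.val '' E) := by
  rw [nu_eq_comap hα,
    (MeasurableEmbedding.subtype_coe measurableSet_I).comap_apply]

theorem isProbabilityMeasure_nu (hα : α ∈ Icc g G) : IsProbabilityMeasure (nu α) := by
  have := isProbabilityMeasure_realNu hα
  refine ⟨?_⟩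
  rw [nu_apply hα, image_univ, Subtype.range_coe]
  exact (prob_compl_eq_zero_iff measurableSet_I).mp realNu_compl_I

theorem map_nu_absolutelyContinuous (hα : α ∈ Icc g G) :
    (nu α).map Subtype.val ≪ (volume : Measure ℝ) := by
  rw [nu_eq_comap hα, (MeasurableEmbedding.subtype_coe measurableSet_I).map_comap]
  exact Measure.restrict_le_self.absolutelyContinuous.trans realNu_absolutelyContinuous

theorem measurable_phi (hα : α ∈ Icc g G) : Measurable (phi α hα) :=
  (measurable_phiReal.comp measurable_subtype_coe).subtype_mk

theorem coe_phi (hα : α ∈ Icc g G) (x : I α) : (phi α hα x : ℝ) = phiReal α x := rfl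

theorem image_phi_preimage (hα : α ∈ Icc g G) (E : Set (I α)) :
    Subtype.val '' (phi α hα ⁻¹' E) = phiReal α ⁻¹' (Subtype.val '' E) ∩ I α := by
  ext x
  simp only [mem_image, mem_preimage, mem_inter_iff]
  constructor
  · rintro ⟨y, hy, rfl⟩
    exact ⟨⟨phi α hα y, hy, coe_phi hα y⟩, y.2⟩
  · rintro ⟨⟨z, hz, hzx⟩, hx⟩
    have : phi α hα ⟨x, hx⟩ = z := Subtype.ext ((coe_phi hα _).trans hzx.symm)
    exact ⟨⟨x, hx⟩, by rwa [this], rfl⟩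

theorem measurePreserving_phi (hα : α ∈ Icc g G) :
    MeasurePreserving (phi α hα) (nu α) (nu α) := by
  refine ⟨measurable_phi hα, Measure.ext fun E hE => ?_⟩
  have hE' := (MeasurableEmbedding.subtype_coe (measurableSet_I (α := α))).measurableSet_image.mpr hE
  rw [Measure.map_apply (measurable_phi hα) hE, nu_apply hα, nu_apply hα,
    ← (measurePreserving_realNu hα).measure_preimage hE'.nullMeasurableSet,
    image_phi_preimage hα, inter_comm, Measure.measure_inter_eq_of_ae]
  exact mem_ae_iff.mpr realNu_compl_I

/-! ### Topological exactness -/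

/-- Some iterate of `φ_α` maps `J` onto almost all of `I α`, in a quantitative sense. -/
def Spreads (α : ℝ) (J : Set ℝ) : Prop :=
  ∃ n : ℕ, ∃ c : ENNReal, c ≠ 0 ∧ ∀ E : Set ℝ, MeasurableSet E →
    c * volume (E ∩ I α) ≤ volume (J ∩ (phiReal α)^[n] ⁻¹' E)

theorem Spreads.mono {J K : Set ℝ} (h : Spreads α J) (hJK : J ⊆ K) : Spreads α K := by
  obtain ⟨n, c, hc, hE⟩ := h
  exact ⟨n, c, hc, fun E hm => (hE E hm).trans (measure_mono (inter_subset_inter_left _ hJK))⟩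

theorem spreads_Ioo_endpoints : Spreads α (Ioo (α - 2) α) := by
  refine ⟨0, 1, one_ne_zero, fun E _ => ?_⟩
  rw [one_mul, inter_comm]
  simp only [Function.iterate_zero, preimage_id]
  refine (measure_congr ?_).le
  exact (Ioo_ae_eq_Ico.symm).inter Filter.EventuallyEq.rfl

theorem volume_image_branch_ge (hα : α ∈ Icc g G) {ε : ℝ} (hε : |ε| = 1) (k : ℕ) {K : Set ℝ}
    (hK : MeasurableSet K) (hKd : K ⊆ branchDom α ε k) :
    ENNReal.ofReal (((2 * k + 3) ^ 2 : ℝ)⁻¹) * volume K ≤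
      volume ((fun w => ε / (2 * k + 1 + w)) '' K) := by
  have hε0 : ε ≠ 0 := by rintro rfl; simp at hε
  obtain ⟨-, hb⟩ := bounds_of_mem hα
  rw [← setLIntegral_one (_ '' K), lintegral_image_eq_lintegral_abs_deriv_mul hK
      (f' := fun w => -ε / (2 * k + 1 + w) ^ 2), ← setLIntegral_const]
  · refine setLIntegral_mono' hK fun w hw => ?_
    obtain ⟨hI, ht, -⟩ := hKd hw
    rw [mul_one, abs_div, abs_neg, hε, abs_pow, sq_abs, one_div]
    refine ENNReal.ofReal_le_ofReal (inv_anti₀ (pow_pos ht 2) ?_)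
    refine pow_le_pow_left₀ ht.le ?_ 2
    linarith [hI.2, G_lt]
  · intro w hw
    have ht := (hKd hw).2.1
    have := (hasDerivAt_const w ε).div ((hasDerivAt_id w).const_add (2 * (k : ℝ) + 1)) ht.ne'
    refine (this.congr_deriv ?_).hasDerivWithinAt
    simp
  · intro w hw w' hw' h
    have ht := (hKd hw).2.1
    have ht' := (hKd hw').2.1
    simp only at h
    rw [div_eq_div_iff ht.ne' ht'.ne'] at h
    have := mul_left_cancel₀ hε0 h
    linarith

/-- Spreading pulls back through one inverse branch, at the cost of one more iterate and of the
least derivative, at least `(2k+3)⁻²` because `w < 2`. -/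
theorem Spreads.of_image (hα : α ∈ Icc g G) {ε : ℝ} (hε : |ε| = 1) (k : ℕ) {J K : Set ℝ}
    (hK : MeasurableSet K) (hKd : K ⊆ branchDom α ε k) (h : Spreads α K)
    (hJ : ∀ w ∈ K, ε / (2 * k + 1 + w) ∈ J) : Spreads α J := by
  have hε0 : ε ≠ 0 := by rintro rfl; simp at hε
  obtain ⟨n, c, hc, hE⟩ := h
  refine ⟨n + 1, ENNReal.ofReal (((2 * k + 3) ^ 2 : ℝ)⁻¹) * c,
    mul_ne_zero (ENNReal.ofReal_pos.mpr (by positivity)).ne' hc, fun E hm => ?_⟩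
  rw [mul_assoc]
  refine (mul_le_mul_right (hE E hm) _).trans ((volume_image_branch_ge hα hε k
    (hK.inter (measurable_phiReal.iterate n hm)) (inter_subset_left.trans hKd)).trans
      (measure_mono ?_))
  rintro _ ⟨w, ⟨hwK, hwE⟩, rfl⟩
  refine ⟨hJ w hwK, ?_⟩
  obtain ⟨hI, ht, -⟩ := hKd hwK
  rw [mem_preimage, Function.iterate_succ_apply, phiReal_branch hI (div_ne_zero hε0 ht.ne')]
  · exact hwE
  · rw [abs_div, hε, abs_of_pos ht]

/-- All one-sided neighbourhoods of `y` in `I α` spread. -/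
def SpreadsAt (α y : ℝ) : Prop :=
  (y < α → ∀ δ > 0, Spreads α (Ioo y (y + δ) ∩ I α)) ∧
    (α - 2 < y → ∀ δ > 0, Spreads α (Ioo (y - δ) y ∩ I α))

/-- For large `k` a full branch squeezes the whole open interval into the given one-sided
neighbourhood of `0`. -/
theorem spreadsAt_zero (hα : α ∈ Icc g G) : SpreadsAt α 0 := by
  have key : ∀ δ > 0, ∃ k : ℕ, 1 ≤ k ∧ ∀ w ∈ Ioo (α - 2) α,
      0 < 1 / (2 * k + 1 + w) ∧ 1 / (2 * k + 1 + w) < δ := by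
    intro δ hδ
    obtain ⟨hb, -⟩ := bounds_of_mem hα
    have := G_gt
    obtain ⟨k, hk⟩ := exists_nat_gt (1 / δ + 1)
    have h0 : 0 < 1 / δ := one_div_pos.mpr hδ
    refine ⟨k, ?_, fun w hw => ?_⟩
    · have : (1 : ℝ) < k := by linarith
      exact_mod_cast this.le
    · have ht : 1 / δ < 2 * k + 1 + w := by linarith [hw.1]
      exact ⟨one_div_pos.mpr (h0.trans ht), (one_div_lt (h0.trans ht) hδ).mpr ht⟩
  refine ⟨fun _ δ hδ => ?_, fun _ δ hδ => ?_⟩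
  · obtain ⟨k, hk, h⟩ := key δ hδ
    have hd : Ioo (α - 2) α ⊆ branchDom α 1 k := fun w hw =>
      mem_branchDom_of_le hα (by simp) hw hk
    refine spreads_Ioo_endpoints.of_image hα (by simp) k measurableSet_Ioo hd fun w hw =>
      ⟨⟨(h w hw).1, by linarith [(h w hw).2]⟩, (hd hw).2.2⟩
  · obtain ⟨k, hk, h⟩ := key δ hδ
    have hd : Ioo (α - 2) α ⊆ branchDom α (-1) k := fun w hw =>
      mem_branchDom_of_le hα (by simp) hw hk
    refine spreads_Ioo_endpoints.of_image hα (by simp) k measurableSet_Ioo hd fun w hw =>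
      ⟨⟨?_, ?_⟩, (hd hw).2.2⟩
    · rw [neg_div]; linarith [(h w hw).2]
    · rw [neg_div]; linarith [(h w hw).1]

/-- Two digit choices are needed, here and in `exists_digit_Ioc`: where `φ_α` jumps, its one-sided
limits are the two endpoints of `I α`. -/
theorem exists_digit_Ico {T : ℝ} (α : ℝ) :
    ∃ k : ℤ, α - 2 ≤ T - (2 * k + 1) ∧ T - (2 * k + 1) < α := by
  refine ⟨⌊(T + 1 - α) / 2⌋, ?_, ?_⟩
  · have := Int.floor_le ((T + 1 - α) / 2); linarith
  · have := Int.lt_floor_add_one ((T + 1 - α) / 2); linarith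

theorem exists_digit_Ioc {T : ℝ} (α : ℝ) :
    ∃ k : ℤ, α - 2 < T - (2 * k + 1) ∧ T - (2 * k + 1) ≤ α := by
  refine ⟨⌈(T - 1 - α) / 2⌉, ?_, ?_⟩
  · have := Int.ceil_lt_add_one ((T - 1 - α) / 2); linarith
  · have := Int.le_ceil ((T - 1 - α) / 2); linarith

/-- Near the left, resp. right, of `y'` the branch `w ↦ ε / (2k+1+w)` takes values in a given
neighbourhood of its value at `y'`. -/
theorem exists_delta_branch {ε y y' s δ : ℝ} (k : ℕ) (ht : 0 < 2 * k + 1 + y')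
    (hy : y = ε / (2 * k + 1 + y')) (hδ : 0 < δ) (hs : 0 < s) :
    ∃ δ' > 0, δ' < s ∧ ∀ w, |w - y'| < δ' → 0 < 2 * k + 1 + w ∧ |ε / (2 * k + 1 + w) - y| < δ := by
  have h1 : ContinuousAt (fun w : ℝ => 2 * (k : ℝ) + 1 + w) y' := by fun_prop
  have h2 : ContinuousAt (fun w : ℝ => ε / (2 * (k : ℝ) + 1 + w)) y' :=
    continuousAt_const.div h1 ht.ne'
  obtain ⟨d1, hd1, h1'⟩ := Metric.eventually_nhds_iff.mp (h1.eventually (lt_mem_nhds ht))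
  obtain ⟨d2, hd2, h2'⟩ := Metric.continuousAt_iff.mp h2 δ hδ
  refine ⟨min (s / 2) (min d1 d2), by positivity, ?_, fun w hw => ⟨h1' ?_, ?_⟩⟩
  · exact (min_le_left _ _).trans_lt (by linarith)
  · exact hw.trans_le ((min_le_right _ _).trans (min_le_left _ _))
  · have := h2' (hw.trans_le ((min_le_right _ _).trans (min_le_right _ _)))
    rw [Real.dist_eq, ← hy] at this
    exact this

theorem SpreadsAt.left_of_branch (hα : α ∈ Icc g G) {ε y y' : ℝ} {k : ℕ} (hε : |ε| = 1)
    (h : SpreadsAt α y') (hy'1 : α - 2 < y') (ht : 0 < 2 * k + 1 + y')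
    (hy : y = ε / (2 * k + 1 + y')) {J : Set ℝ} {δ : ℝ} (hδ : 0 < δ)
    (hJI : J ⊆ I α)
    (hJ : ∀ w, w < y' → 0 < 2 * k + 1 + w → |ε / (2 * k + 1 + w) - y| < δ →
      ε / (2 * k + 1 + w) ∈ J) : Spreads α J := by
  obtain ⟨δ', h0, hs, hw⟩ := exists_delta_branch k ht hy hδ (sub_pos.mpr hy'1)
  have hm : ∀ w ∈ Ioo (y' - δ') y' ∩ I α, 0 < 2 * k + 1 + w ∧ ε / (2 * k + 1 + w) ∈ J := by
    intro w hwm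
    have := hw w (by rw [abs_lt]; constructor <;> linarith [hwm.1.1, hwm.1.2])
    exact ⟨this.1, hJ w hwm.1.2 this.1 this.2⟩
  exact (h.2 hy'1 δ' h0).of_image hα hε k (measurableSet_Ioo.inter measurableSet_I)
    (fun w hwm => ⟨hwm.2, (hm w hwm).1, hJI (hm w hwm).2⟩) fun w hwm => (hm w hwm).2

theorem SpreadsAt.right_of_branch (hα : α ∈ Icc g G) {ε y y' : ℝ} {k : ℕ} (hε : |ε| = 1)
    (h : SpreadsAt α y') (hy'2 : y' < α) (ht : 0 < 2 * k + 1 + y')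
    (hy : y = ε / (2 * k + 1 + y')) {J : Set ℝ} {δ : ℝ} (hδ : 0 < δ)
    (hJI : J ⊆ I α)
    (hJ : ∀ w, y' < w → 0 < 2 * k + 1 + w → |ε / (2 * k + 1 + w) - y| < δ →
      ε / (2 * k + 1 + w) ∈ J) : Spreads α J := by
  obtain ⟨δ', h0, hs, hw⟩ := exists_delta_branch k ht hy hδ one_pos
  have hm : ∀ w ∈ Ioo y' (y' + δ') ∩ I α, 0 < 2 * k + 1 + w ∧ ε / (2 * k + 1 + w) ∈ J := by
    intro w hwm
    have := hw w (by rw [abs_lt]; constructor <;> linarith [hwm.1.1, hwm.1.2])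
    exact ⟨this.1, hJ w hwm.1.1 this.1 this.2⟩
  exact (h.1 hy'2 δ' h0).of_image hα hε k (measurableSet_Ioo.inter measurableSet_I)
    (fun w hwm => ⟨hwm.2, (hm w hwm).1, hJI (hm w hwm).2⟩) fun w hwm => (hm w hwm).2

/-- One side of `y` is covered by a branch near the right of `1/|y| - (2k+1)`, the other by a branch
near the left of `1/|y| - (2k'+1)`. The sign of `y` decides which is which, since it fixes the
monotonicity of the branch. -/
theorem SpreadsAt.of_branches (hα : α ∈ Icc g G) {y : ℝ} (hy1 : α - 2 ≤ y) (hy2 : y ≤ α)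
    (hy0 : y ≠ 0) {k k' : ℕ}
    (hk : 1 / |y| - (2 * k + 1) < α) (hk' : α - 2 < 1 / |y| - (2 * k' + 1))
    (h : SpreadsAt α (1 / |y| - (2 * k + 1))) (h' : SpreadsAt α (1 / |y| - (2 * k' + 1))) :
    SpreadsAt α y := by
  have hT : 0 < 1 / |y| := one_div_pos.mpr (abs_pos.mpr hy0)
  have e : ∀ k : ℕ, 2 * k + 1 + (1 / |y| - (2 * k + 1)) = 1 / |y| := fun k => by ring
  rcases lt_or_gt_of_ne hy0 with hneg | hpos
  · have hy : ∀ k : ℕ, y = -1 / (2 * k + 1 + (1 / |y| - (2 * k + 1))) := fun k => by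
      rw [e, abs_of_neg hneg]; field_simp
    have hmono : ∀ (k : ℕ) (w w' : ℝ), 0 < 2 * k + 1 + w → w < w' →
        -1 / (2 * k + 1 + w) < -1 / (2 * k + 1 + w') := fun k w w' hw hww => by
      rw [neg_div, neg_div, neg_lt_neg_iff]
      exact one_div_lt_one_div_of_lt hw (by linarith)
    refine ⟨fun hlt δ hδ => ?_, fun hlt δ hδ => ?_⟩
    · refine h.right_of_branch hα (by simp) hk (by rw [e]; exact hT) (hy k)
        (δ := min δ (α - y)) (lt_min hδ (sub_pos.mpr hlt)) inter_subset_right ?_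
      intro w hw ht hd
      have h1 := hmono k _ _ (by rw [e]; exact hT) hw
      rw [← hy k] at h1
      rw [lt_min_iff] at hd
      have h2 := (abs_lt.mp hd.1).2
      have h3 := (abs_lt.mp hd.2).2
      exact ⟨⟨h1, by linarith⟩, by linarith, by linarith⟩
    · refine h'.left_of_branch hα (by simp) hk' (by rw [e]; exact hT) (hy k')
        (δ := min δ (y - (α - 2))) (lt_min hδ (sub_pos.mpr hlt)) inter_subset_right ?_
      intro w hw ht hd
      have h1 := hmono k' _ _ ht hw
      rw [← hy k'] at h1
      rw [lt_min_iff] at hd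
      have h2 := (abs_lt.mp hd.1).1
      have h3 := (abs_lt.mp hd.2).1
      exact ⟨⟨by linarith, h1⟩, by linarith, by linarith⟩
  · have hy : ∀ k : ℕ, y = 1 / (2 * k + 1 + (1 / |y| - (2 * k + 1))) := fun k => by
      rw [e, abs_of_pos hpos]; field_simp
    have hanti : ∀ (k : ℕ) (w w' : ℝ), 0 < 2 * k + 1 + w → w < w' →
        1 / (2 * k + 1 + w') < 1 / (2 * k + 1 + w) := fun k w w' hw hww =>
      one_div_lt_one_div_of_lt hw (by linarith)
    refine ⟨fun hlt δ hδ => ?_, fun hlt δ hδ => ?_⟩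
    · refine h'.left_of_branch hα (by simp) hk' (by rw [e]; exact hT) (hy k')
        (δ := min δ (α - y)) (lt_min hδ (sub_pos.mpr hlt)) inter_subset_right ?_
      intro w hw ht hd
      have h1 := hanti k' _ _ ht hw
      rw [← hy k'] at h1
      rw [lt_min_iff] at hd
      have h2 := (abs_lt.mp hd.1).2
      have h3 := (abs_lt.mp hd.2).2
      exact ⟨⟨h1, by linarith⟩, by linarith, by linarith⟩
    · refine h.right_of_branch hα (by simp) hk (by rw [e]; exact hT) (hy k)
        (δ := min δ (y - (α - 2))) (lt_min hδ (sub_pos.mpr hlt)) inter_subset_right ?_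
      intro w hw ht hd
      have h1 := hanti k _ _ (by rw [e]; exact hT) hw
      rw [← hy k] at h1
      rw [lt_min_iff] at hd
      have h2 := (abs_lt.mp hd.1).1
      have h3 := (abs_lt.mp hd.2).1
      exact ⟨⟨by linarith, h1⟩, by linarith, by linarith⟩

/-- If `|y| = p/q` in lowest terms, then `z = (q - np)/p` has denominator dividing `p`, and `|z| <
q/p` makes its numerator smaller than `q`. -/
theorem rat_height_lt {y : ℚ} {n : ℤ} (hy : y ≠ 0) (h : |1 / |y| - n| < 1 / |y|) :
    (1 / |y| - n).num.natAbs + (1 / |y| - n).den < y.num.natAbs + y.den := by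
  set z := 1 / |y| - (n : ℚ) with hz
  have hden : z.den ≤ y.num.natAbs := by
    have h1 : z = ((y.den - n * y.num.natAbs : ℤ) : ℚ) / (y.num.natAbs : ℤ) := by
      have hn : ((y.num.natAbs : ℤ) : ℚ) ≠ 0 := by
        simpa using hy
      have h2 : |y| = (y.num.natAbs : ℤ) / (y.den : ℚ) := by
        conv_lhs => rw [← Rat.num_div_den y]
        rw [abs_div, Nat.abs_cast]
        congr 1
        rw [Int.natCast_natAbs]; push_cast; rfl
      rw [hz, h2, one_div_div]
      push_cast at hn ⊢
      field_simp
    have h3 : (z.den : ℤ) ∣ (y.num.natAbs : ℤ) := by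
      rw [h1, ← Rat.divInt_eq_div]; exact Rat.den_dvd _ _
    exact Nat.le_of_dvd (Int.natAbs_pos.mpr (Rat.num_ne_zero.mpr hy)) (Int.natCast_dvd_natCast.mp h3)
  have habs : ∀ q : ℚ, (q.num.natAbs : ℚ) = |q| * q.den := fun q => by
    have h1 : |q| * q.den = |q * q.den| := by rw [abs_mul, Nat.abs_cast]
    rw [h1, Rat.mul_den_eq_num, Nat.cast_natAbs, Int.cast_abs]
  have hnum : z.num.natAbs < y.den := by
    have h1 : (z.num.natAbs : ℚ) < y.den := by
      have hp : 0 < |y| := abs_pos.mpr hy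
      have h2 : (y.den : ℚ) = 1 / |y| * y.num.natAbs := by
        rw [habs y]; field_simp
      rw [habs z, h2]
      have h3 : (z.den : ℚ) ≤ y.num.natAbs := by exact_mod_cast hden
      have h4 : (0 : ℚ) < z.den := by exact_mod_cast z.den_pos
      calc |z| * z.den < 1 / |y| * z.den := by gcongr
        _ ≤ _ := by gcongr
    exact_mod_cast h1
  omega

theorem irrational_G : Irrational G := by
  have : G = Real.goldenRatio := by unfold G Real.goldenRatio; ring
  rw [this]; exact Real.goldenRatio_irrational

theorem nonneg_and_abs_lt_of_digit (hα : α ∈ Icc g G) {T : ℝ} (hT : G - 1 < T) {k : ℤ}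
    (h1 : α - 2 ≤ T - (2 * k + 1)) (h2 : T - (2 * k + 1) ≤ α) :
    0 ≤ k ∧ |T - (2 * k + 1)| < T := by
  obtain ⟨hb1, hb2⟩ := bounds_of_mem hα
  have := G_gt
  have hk : 0 ≤ k := by
    by_contra! h
    have : (k : ℝ) ≤ -1 := by exact_mod_cast (by omega : k ≤ -1)
    linarith
  refine ⟨hk, ?_⟩
  have hk' : (0 : ℝ) ≤ k := by exact_mod_cast hk
  rw [abs_lt]
  refine ⟨?_, by linarith⟩
  rcases hk.eq_or_lt with rfl | h
  · push_cast; linarith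
  · have : (1 : ℝ) ≤ k := by exact_mod_cast h
    linarith

theorem spreadsAt_rat (hα : α ∈ Icc g G) (y : ℚ) (hy1 : α - 2 ≤ y) (hy2 : y ≤ α) :
    SpreadsAt α y := by
  induction hn : y.num.natAbs + y.den using Nat.strong_induction_on generalizing y with
  | _ N ih =>
  subst hn
  rcases eq_or_ne y 0 with rfl | hy0
  · simpa using spreadsAt_zero hα
  have hy0' : (y : ℝ) ≠ 0 := by exact_mod_cast hy0
  obtain ⟨hb1, hb2⟩ := bounds_of_mem hα
  have hG := G_gt
  have hT : G - 1 < 1 / |(y : ℝ)| := by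
    have hle : |(y : ℝ)| ≤ G := by rw [abs_le]; constructor <;> linarith
    -- The strict bound is what excludes negative digits; equality is impossible because `G` is
    -- irrational.
    have hlt : |(y : ℝ)| < G := lt_of_le_of_ne hle fun h => by
      have := irrational_G.ne_rat |y|
      rw [← h] at this
      exact this (by push_cast; rfl)
    rw [lt_div_iff₀ (abs_pos.mpr hy0')]
    nlinarith [G_sq]
  obtain ⟨k, hk1, hk2⟩ := exists_digit_Ico (T := 1 / |(y : ℝ)|) α
  obtain ⟨k', hk'1, hk'2⟩ := exists_digit_Ioc (T := 1 / |(y : ℝ)|) α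
  have step : ∀ k : ℤ, α - 2 ≤ 1 / |(y : ℝ)| - (2 * k + 1) → 1 / |(y : ℝ)| - (2 * k + 1) ≤ α →
      0 ≤ k ∧ SpreadsAt α (1 / |(y : ℝ)| - (2 * k + 1)) := by
    intro k h1 h2
    obtain ⟨h3, h4⟩ := nonneg_and_abs_lt_of_digit hα hT h1 h2
    have e : 1 / |(y : ℝ)| - (2 * k + 1) = ((1 / |y| - (2 * k + 1 : ℤ) : ℚ) : ℝ) := by
      push_cast; rfl
    have h5 : |1 / |y| - ((2 * k + 1 : ℤ) : ℚ)| < 1 / |y| := by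
      have : ((|1 / |y| - ((2 * k + 1 : ℤ) : ℚ)| : ℚ) : ℝ) < ((1 / |y| : ℚ) : ℝ) := by
        push_cast; exact h4
      exact_mod_cast this
    refine ⟨h3, ?_⟩
    rw [e] at h1 h2 ⊢
    exact ih _ (rat_height_lt hy0 h5) _ h1 h2 rfl
  obtain ⟨hk0, hS⟩ := step k hk1 hk2.le
  obtain ⟨hk'0, hS'⟩ := step k' hk'1.le hk'2
  lift k to ℕ using hk0
  lift k' to ℕ using hk'0
  simp only [Int.cast_natCast] at hS hS' hk2 hk'1
  exact SpreadsAt.of_branches hα hy1 hy2 hy0' hk2 hk'1 hS hS'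

/-- Topological exactness of `φ_α`. -/
theorem spreads_Ioo (hα : α ∈ Icc g G) {p q : ℝ} (hp : α - 2 ≤ p) (hpq : p < q) (hq : q ≤ α) :
    Spreads α (Ioo p q) := by
  obtain ⟨y, h1, h2⟩ := exists_rat_btwn hpq
  refine ((spreadsAt_rat hα y (by linarith) (by linarith)).1 (by linarith) (q - y)
    (by linarith)).mono fun x hx => ⟨by linarith [hx.1.1], by linarith [hx.1.2]⟩

theorem surjOn_phiReal (hα : α ∈ Icc g G) : SurjOn (phiReal α) (I α) (I α) := by
  obtain ⟨h1, h2⟩ := bounds_of_mem hα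
  have := G_gt
  have := G_lt
  intro w hw
  have ht : 3 ≤ 2 * ((2 : ℕ) : ℝ) + 1 + w := by push_cast; linarith [hw.1]
  have h0 : 0 < 1 / (2 * ((2 : ℕ) : ℝ) + 1 + w) := one_div_pos.mpr (by linarith)
  have h3 : 1 / (2 * ((2 : ℕ) : ℝ) + 1 + w) ≤ 1 / 3 := one_div_le_one_div_of_le (by norm_num) ht
  exact ⟨_, ⟨by linarith, by linarith⟩, phiReal_branch hw h0.ne' (abs_of_pos h0)⟩

/-! ### Exactness by density points and bounded distortion -/

/-- Union bound: by invariance, time `i` costs at most `7 · 2 · 4 (7/8)^(n-i) r`, and the geometric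
sum is at most `8 · 56 r = 448 r`. The decaying margin is what makes this uniform in `n`. -/
theorem realNu_not_farFromEndpoints_le (hα : α ∈ Icc g G) (hr : 0 < r) (n : ℕ) :
    realNu α {x | ¬ FarFromEndpoints α r n x} ≤ ENNReal.ofReal (448 * r) := by
  have hq : ∀ j : ℕ, 0 ≤ (7 / 8 : ℝ) ^ j * r := fun j => by positivity
  let Z : ℝ → Set ℝ := fun s => {0} ∪ (Iic (α - 2 + s) ∪ Ici (α - s))
  have hZm : ∀ s, MeasurableSet (Z s) := fun s =>
    (measurableSet_singleton _).union (measurableSet_Iic.union measurableSet_Ici)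
  have hZ : ∀ s, 0 ≤ s → realNu α (Z s) ≤ 7 * ENNReal.ofReal (2 * s) := by
    intro s hs
    refine (realNu_le hα (hZm s)).trans (mul_le_mul_right ?_ _)
    have hsub : Z s ∩ I α ⊆ {0} ∪ (Icc (α - 2) (α - 2 + s) ∪ Icc (α - s) α) := by
      rintro x ⟨h | h | h, hx⟩
      · exact Or.inl h
      · exact Or.inr (Or.inl ⟨hx.1, h⟩)
      · exact Or.inr (Or.inr ⟨h, hx.2.le⟩)
    refine (measure_mono hsub).trans ((measure_union_le _ _).trans ?_)
    rw [measure_singleton, zero_add]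
    refine (measure_union_le _ _).trans ?_
    rw [Real.volume_Icc, Real.volume_Icc, ← ENNReal.ofReal_add (by linarith) (by linarith)]
    exact (congrArg ENNReal.ofReal (by ring)).le
  have hsub : {x | ¬ FarFromEndpoints α r n x} ⊆
      ⋃ i ∈ Finset.range (n + 1), (phiReal α)^[i] ⁻¹' Z (4 * (7 / 8) ^ (n - i) * r) := by
    intro x hx
    simp only [FarFromEndpoints, mem_ofPred_eq, not_forall] at hx
    obtain ⟨i, hi, h⟩ := hx
    simp only [mem_iUnion, Finset.mem_range]
    refine ⟨i, by omega, ?_⟩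
    simp only [mem_preimage, Z, mem_union, mem_singleton_iff, mem_Iic, mem_Ici]
    by_contra! hcon
    exact h ⟨hcon.1, hcon.2.1, hcon.2.2⟩
  refine (measure_mono hsub).trans ((measure_biUnion_finset_le _ _).trans ?_)
  have hle : ∀ i ∈ Finset.range (n + 1),
      realNu α ((phiReal α)^[i] ⁻¹' Z (4 * (7 / 8) ^ (n - i) * r)) ≤
        ENNReal.ofReal (56 * ((7 / 8) ^ (n - i) * r)) := by
    intro i _
    rw [((measurePreserving_realNu hα).iterate i).measure_preimage (hZm _).nullMeasurableSet]
    refine (hZ _ (by have := hq (n - i); linarith)).trans (le_of_eq ?_)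
    rw [← ENNReal.ofReal_ofNat, ← ENNReal.ofReal_mul (by norm_num)]
    congr 1; ring
  refine (Finset.sum_le_sum hle).trans ?_
  rw [← ENNReal.ofReal_sum_of_nonneg fun i _ => by have := hq (n - i); linarith]
  refine ENNReal.ofReal_le_ofReal ?_
  rw [← Finset.mul_sum, ← Finset.sum_mul, Finset.sum_flip (fun j => (7 / 8 : ℝ) ^ j),
    geom_sum_eq (by norm_num)]
  have := hq (n + 1)
  have e : 56 * (((7 / 8 : ℝ) ^ (n + 1) - 1) / (7 / 8 - 1) * r) =
      448 * r - 448 * ((7 / 8) ^ (n + 1) * r) := by ring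
  rw [e]; linarith

/-- The inverse branch sends the ball about `φ^n x` into the ball of radius `3 D r` about `x`, where
`D` is its derivative at the centre. As `224 r ≤ 1`, derivatives vary by a factor at most `e < 3`,
so volumes shrink by no more than `D/3`. Dividing by the volume `6 D r` accounts for the factor
`18`. -/
theorem volume_inter_closedBall_le (hα : α ∈ Icc g G) (hr : 0 < r) (hr' : r ≤ 1 / 224) {n : ℕ}
    {x : ℝ} (h : FarFromEndpoints α r n x) {E S : Set ℝ} (hE : MeasurableSet E)
    (hS : ∀ z ∈ I α, (phiReal α)^[n] z ∈ E → z ∈ S) :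
    ∃ δ, 0 < δ ∧ δ ≤ 12 * (7 / 8) ^ n ∧
      volume (E ∩ Metric.closedBall ((phiReal α)^[n] x) r) ≤
        18 * (volume (S ∩ Metric.closedBall x δ) / volume (Metric.closedBall x δ)) := by
  have hr'' : r ≤ 0.01 := hr'.trans (by norm_num)
  set y := (phiReal α)^[n] x with hy
  have hball : ∀ w, w ∈ Metric.closedBall y r ↔ |w - y| ≤ r := fun w => by
    rw [Metric.mem_closedBall, Real.dist_eq]
  have hyy : |y - y| ≤ r := by rw [sub_self, abs_zero]; exact hr.le
  have hexp : ∀ w w', |w - y| ≤ r → |w' - y| ≤ r →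
      psiDeriv α n x w ≤ 3 * psiDeriv α n x w' := fun w w' hw hw' => by
    refine (psiDeriv_distortion hα hr hr'' n h hw hw').trans ?_
    refine mul_le_mul_of_nonneg_right ?_ (psiDeriv_pos hα hr hr'' n h hw').le
    have : (0 : ℝ) < (7 / 8) ^ n := by positivity
    calc Real.exp (224 * r * (1 - (7 / 8) ^ n)) ≤ Real.exp 1 := by
          apply Real.exp_le_exp.mpr; nlinarith
      _ ≤ 3 := by linarith [Real.exp_one_lt_d9]
  set D := psiDeriv α n x y with hD
  have hD0 : 0 < D := psiDeriv_pos hα hr hr'' n h hyy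
  have hDle : D ≤ 4 * (7 / 8) ^ n := psiDeriv_le hα hr hr'' n h hyy
  choose! s hs hd using fun w (hw : |w - y| ≤ r) => hasDerivAt_psi hα hr hr'' n h hw
  have hspec := psiSpec hα hr hr'' n x h
  have hEm : MeasurableSet (E ∩ Metric.closedBall y r) := hE.inter Metric.isClosed_closedBall.measurableSet
  have hinj : InjOn (psi α n x) (E ∩ Metric.closedBall y r) := by
    intro w hw w' hw' heq
    rw [← (hspec.1 w ((hball w).mp hw.2)).2, heq, (hspec.1 w' ((hball w').mp hw'.2)).2]
  have himage : psi α n x '' (E ∩ Metric.closedBall y r) ⊆ S ∩ Metric.closedBall x (3 * D * r) := by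
    rintro _ ⟨w, ⟨hwE, hw⟩, rfl⟩
    obtain ⟨h1, h2⟩ := hspec.1 w ((hball w).mp hw)
    refine ⟨hS _ h1 (by rwa [h2]), ?_⟩
    have := (convex_closedBall y r).norm_image_sub_le_of_norm_hasDerivWithin_le (f := psi α n x)
      (C := 3 * D) (fun z hz => (hd z ((hball z).mp hz)).hasDerivWithinAt)
      (fun z hz => by
        rw [Real.norm_eq_abs, hs z ((hball z).mp hz)]
        exact hexp z y ((hball z).mp hz) hyy)
      (Metric.mem_closedBall_self hr.le) hw
    rw [psi_iterate h, Real.norm_eq_abs, Real.norm_eq_abs] at this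
    rw [Metric.mem_closedBall, Real.dist_eq]
    refine this.trans ?_
    exact mul_le_mul_of_nonneg_left ((hball w).mp hw) (by positivity)
  have hvol : ENNReal.ofReal (D / 3) * volume (E ∩ Metric.closedBall y r) ≤
      volume (S ∩ Metric.closedBall x (3 * D * r)) := by
    refine le_trans ?_ (measure_mono himage)
    rw [← setLIntegral_one (_ '' _), lintegral_image_eq_lintegral_abs_deriv_mul hEm
      (fun w hw => (hd w ((hball w).mp hw.2)).hasDerivWithinAt) hinj, ← setLIntegral_const]
    refine setLIntegral_mono' hEm fun w hw => ?_
    rw [mul_one, hs w ((hball w).mp hw.2)]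
    refine ENNReal.ofReal_le_ofReal ?_
    have := hexp y w hyy ((hball w).mp hw.2)
    linarith
  refine ⟨3 * D * r, by positivity, ?_, ?_⟩
  · have : 3 * D * r ≤ 3 * D * 1 := by gcongr; linarith
    linarith
  · rw [Real.volume_closedBall, ← mul_div_assoc, ENNReal.le_div_iff_mul_le
      (Or.inl (ENNReal.ofReal_pos.mpr (by positivity)).ne') (Or.inl ENNReal.ofReal_ne_top)]
    refine le_trans ?_ (mul_le_mul_right hvol 18)
    have e : (18 : ENNReal) * ENNReal.ofReal (D / 3) = ENNReal.ofReal (6 * D) := by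
      rw [← ENNReal.ofReal_ofNat 18, ← ENNReal.ofReal_mul (by norm_num)]
      congr 1
      linarith
    rw [← mul_assoc 18, e, mul_comm]
    refine mul_le_mul_left (ENNReal.ofReal_le_ofReal ?_) _
    have : D * r ≤ D * 1 := by gcongr; linarith
    linarith

theorem exists_uniform_spread (hα : α ∈ Icc g G) (hr : 0 < r) :
    ∃ c : ENNReal, c ≠ 0 ∧ ∀ y, α - 2 ≤ y → y + r ≤ α → ∃ k : ℕ, ∀ E, MeasurableSet E →
      c * volume (E ∩ I α) ≤ volume (Metric.closedBall y r ∩ (phiReal α)^[k] ⁻¹' E) := by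
  let J : ℕ → Set ℝ := fun j => Ioo (α - 2 + j * (r / 2)) (α - 2 + (j + 1) * (r / 2))
  have hJ : ∀ j : ℕ, ∃ c : ENNReal, c ≠ 0 ∧ (α - 2 + (j + 1) * (r / 2) ≤ α → ∃ k : ℕ,
      ∀ E, MeasurableSet E → c * volume (E ∩ I α) ≤ volume (J j ∩ (phiReal α)^[k] ⁻¹' E)) := by
    intro j
    by_cases hj : α - 2 + (j + 1) * (r / 2) ≤ α
    · obtain ⟨k, c, hc, h⟩ := spreads_Ioo hα (p := α - 2 + j * (r / 2))
        (by have : (0 : ℝ) ≤ j * (r / 2) := by positivity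
            linarith) (by linarith) hj
      exact ⟨c, hc, fun _ => ⟨k, h⟩⟩
    · exact ⟨1, one_ne_zero, fun h => absurd h hj⟩
  choose c hc h using hJ
  -- `I α` has length `2`, so finitely many cells of length `r/2` suffice and the least of their
  -- constants works. Each ball contains the cell in which its centre falls.
  obtain ⟨M, hM⟩ := exists_nat_gt (2 / (r / 2))
  refine ⟨(Finset.range M).inf c, ?_, fun y hy1 hy2 => ?_⟩
  · rw [← pos_iff_ne_zero, Finset.lt_inf_iff ENNReal.zero_lt_top]
    exact fun j _ => pos_iff_ne_zero.mpr (hc j)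
  · have hr2 : 0 < r / 2 := by linarith
    have h0 : 0 ≤ (y - (α - 2)) / (r / 2) := div_nonneg (by linarith) hr2.le
    set j := ⌊(y - (α - 2)) / (r / 2)⌋₊ with hj
    have f1 := Nat.floor_le h0
    have f2 := Nat.lt_floor_add_one ((y - (α - 2)) / (r / 2))
    rw [← hj] at f1 f2
    rw [le_div_iff₀ hr2] at f1
    rw [div_lt_iff₀ hr2] at f2
    have hjM : j < M := by
      have h3 : (j : ℝ) < M := by
        refine lt_trans ?_ hM
        rw [lt_div_iff₀ hr2]; linarith
      exact_mod_cast h3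
    obtain ⟨k, hk⟩ := h j (by linarith)
    refine ⟨k, fun E hE => ?_⟩
    refine (mul_le_mul_left (Finset.inf_le (Finset.mem_range.mpr hjM)) _).trans
      ((hk E hE).trans (measure_mono (inter_subset_inter_left _ fun z hz => ?_)))
    rw [Metric.mem_closedBall, Real.dist_eq, abs_le]
    constructor <;> linarith [hz.1, hz.2]

theorem realNu_not_frequently_le (hα : α ∈ Icc g G) (hr : 0 < r) :
    realNu α {x | ¬ ∃ᶠ n in Filter.atTop, FarFromEndpoints α r n x} ≤ ENNReal.ofReal (448 * r) := by
  have e : {x | ¬ ∃ᶠ n in Filter.atTop, FarFromEndpoints α r n x} =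
      ⋃ N : ℕ, ⋂ n ≥ N, {x | ¬ FarFromEndpoints α r n x} := by
    ext x
    simp only [Filter.not_frequently, Filter.eventually_atTop, mem_ofPred_eq, mem_iUnion,
      mem_iInter]
  have hmono : Monotone fun N : ℕ => ⋂ n ≥ N, {x | ¬ FarFromEndpoints α r n x} :=
    fun N N' hN => biInter_subset_biInter_left fun n hn => le_trans hN hn
  rw [e, hmono.measure_iUnion]
  exact iSup_le fun N => (measure_mono (biInter_subset_of_mem (le_refl N))).trans
    (realNu_not_farFromEndpoints_le hα hr N)

/-- The zero-one law for a tail set `B 0` on the line, with `B n` the set whose `n`-th preimage it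
is. -/
theorem realNu_eq_zero_or_compl (hα : α ∈ Icc g G) {B : ℕ → Set ℝ}
    (hB : ∀ n, MeasurableSet (B n))
    (hpre : ∀ n, ∀ x ∈ I α, (phiReal α)^[n] x ∈ B n ↔ x ∈ B 0) :
    realNu α (B 0) = 0 ∨ realNu α (B 0)ᶜ = 0 := by
  have hprob := isProbabilityMeasure_realNu hα
  rcases eq_or_ne (realNu α (B 0)) 0 with h0 | h0
  · exact Or.inl h0
  right
  -- Only preimages of `B n` in `I α` are known; surjectivity of the iterates transfers the relation
  -- to `B n` itself.
  have hshift : ∀ n k, ∀ y ∈ I α, (phiReal α)^[k] y ∈ B (n + k) ↔ y ∈ B n := by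
    intro n k y hy
    obtain ⟨x, hx, rfl⟩ := (surjOn_phiReal hα).iterate n hy
    rw [hpre n x hx, ← hpre (n + k) x hx, add_comm, Function.iterate_add_apply]
  have hinv : ∀ n, realNu α (B 0)ᶜ = realNu α (B n)ᶜ := by
    intro n
    rw [← ((measurePreserving_realNu hα).iterate n).measure_preimage (hB n).compl.nullMeasurableSet]
    have hae : ∀ᵐ x ∂realNu α, x ∈ I α := mem_ae_iff.mpr realNu_compl_I
    refine measure_congr ?_
    filter_upwards [hae] with x hx
    exact propext (not_congr (hpre n x hx)).symm
  obtain ⟨d, hd0, hd⟩ := ENNReal.lt_iff_exists_real_btwn.mp (pos_iff_ne_zero.mpr h0)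
  have hdpos : 0 < d := ENNReal.ofReal_pos.mp hd.1
  -- With `448 r ≤ d < ν(B 0)`, the points that are far from the endpoints only finitely often
  -- cannot exhaust `B 0`.
  obtain ⟨r, hr, hr', hrd⟩ : ∃ r : ℝ, 0 < r ∧ r ≤ 1 / 224 ∧ 448 * r ≤ d :=
    ⟨min (1 / 224) (d / 448), by positivity, min_le_left _ _, by
      have := min_le_right (1 / 224 : ℝ) (d / 448); linarith⟩
  have hdens : ∀ᵐ x ∂(volume : Measure ℝ), Filter.Tendsto
      (fun δ => volume ((B 0)ᶜ ∩ Metric.closedBall x δ) / volume (Metric.closedBall x δ))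
      (nhdsWithin 0 (Ioi 0)) (nhds ((B 0)ᶜ.indicator 1 x)) :=
    Besicovitch.ae_tendsto_measure_inter_div_of_measurableSet volume (hB 0).compl
  obtain ⟨x, hxB, hxfreq, hxdens⟩ : ∃ x ∈ B 0, (∃ᶠ n in Filter.atTop, FarFromEndpoints α r n x) ∧
      Filter.Tendsto
        (fun δ => volume ((B 0)ᶜ ∩ Metric.closedBall x δ) / volume (Metric.closedBall x δ))
        (nhdsWithin 0 (Ioi 0)) (nhds 0) := by
    by_contra! hcon
    have hsub : ∀ᵐ x ∂realNu α, x ∈ B 0 →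
        x ∈ {x | ¬ ∃ᶠ n in Filter.atTop, FarFromEndpoints α r n x} := by
      filter_upwards [realNu_absolutelyContinuous.ae_le hdens] with x hx hxB hfreq
      rw [indicator_of_notMem (not_not.mpr hxB : x ∉ (B 0)ᶜ)] at hx
      exact hcon x hxB hfreq hx
    have h1 : realNu α (B 0) ≤ ENNReal.ofReal (448 * r) :=
      (measure_mono_ae hsub).trans (realNu_not_frequently_le hα hr)
    exact absurd (h1.trans (ENNReal.ofReal_le_ofReal hrd)) (not_le.mpr hd.2)
  obtain ⟨c, hc, hspread⟩ := exists_uniform_spread hα hr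
  -- The constant `c` depends on `r` only, not on the time `n` or on `η`, so letting `η → 0` forces
  -- the complement to be null.
  have hbound : ∀ η : ENNReal, 0 < η → c * realNu α (B 0)ᶜ ≤ 7 * (18 * η) := by
    intro η hη
    obtain ⟨t, ht, htη⟩ := mem_nhdsGT_iff_exists_Ioo_subset.mp (hxdens.eventually (gt_mem_nhds hη))
    have hlim : Filter.Tendsto (fun n : ℕ => 12 * (7 / 8 : ℝ) ^ n) Filter.atTop (nhds 0) := by
      have := (tendsto_pow_atTop_nhds_zero_of_lt_one (r := (7 / 8 : ℝ)) (by norm_num)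
        (by norm_num)).const_mul 12
      rwa [mul_zero] at this
    obtain ⟨n, hn, hnt⟩ := (hxfreq.and_eventually (hlim.eventually (gt_mem_nhds ht))).exists
    obtain ⟨δ, hδ0, hδ, hvol⟩ := volume_inter_closedBall_le hα hr hr' hn (E := (B n)ᶜ)
      (S := (B 0)ᶜ) (hB n).compl fun z hz hzn h => hzn ((hpre n z hz).mpr h)
    have hratio : volume ((B 0)ᶜ ∩ Metric.closedBall x δ) / volume (Metric.closedBall x δ) < η :=
      htη ⟨hδ0, hδ.trans_lt hnt⟩
    have hend := (hn n le_rfl).2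
    rw [Nat.sub_self, pow_zero, mul_one] at hend
    obtain ⟨k, hk⟩ := hspread ((phiReal α)^[n] x) (by linarith) (by linarith)
    have hball : Metric.closedBall ((phiReal α)^[n] x) r ⊆ I α := fun z hz => by
      rw [Metric.mem_closedBall, Real.dist_eq, abs_le] at hz
      constructor <;> linarith
    have h1 : c * volume ((B (n + k))ᶜ ∩ I α) ≤ 18 * η := by
      refine (hk _ (hB (n + k)).compl).trans ((measure_mono ?_).trans
        (hvol.trans (mul_le_mul_right hratio.le _)))
      rintro z ⟨hz, hzk⟩
      exact ⟨fun h => hzk ((hshift n k z (hball hz)).mpr h), hz⟩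
    calc c * realNu α (B 0)ᶜ ≤ c * (7 * volume ((B (n + k))ᶜ ∩ I α)) := by
          rw [hinv (n + k)]; exact mul_le_mul_right (realNu_le hα (hB _).compl) _
      _ = 7 * (c * volume ((B (n + k))ᶜ ∩ I α)) := mul_left_comm _ _ _
      _ ≤ 7 * (18 * η) := mul_le_mul_right h1 _
  have hzero : c * realNu α (B 0)ᶜ = 0 := by
    refine le_antisymm (ENNReal.le_of_forall_pos_le_add fun ε hε _ => ?_) zero_le
    rw [zero_add]
    refine (hbound (ε / 126) (ENNReal.div_pos (by exact_mod_cast hε.ne') (by norm_num))).trans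
      (le_of_eq ?_)
    rw [← mul_assoc, show (7 : ENNReal) * 18 = 126 by norm_num,
      ENNReal.mul_div_cancel (by norm_num) (by norm_num)]
  exact (mul_eq_zero.mp hzero).resolve_left hc

theorem coe_iterate_phi (hα : α ∈ Icc g G) (n : ℕ) (x : I α) :
    ((phi α hα)^[n] x : ℝ) = (phiReal α)^[n] x := by
  induction n generalizing x with
  | zero => rfl
  | succ n ih => rw [Function.iterate_succ_apply, ih, coe_phi, Function.iterate_succ_apply]

/-- `φ_α` is exact. -/
theorem isExact_phi (hα : α ∈ Icc g G) : IsExact (phi α hα) (nu α) := by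
  refine ⟨measurePreserving_phi hα, fun A hA => ?_⟩
  have hA' : ∀ n : ℕ, ∃ C : Set (I α), MeasurableSet C ∧ (phi α hα)^[n] ⁻¹' C = A := fun n =>
    MeasurableSpace.measurableSet_iInf.mp hA n
  choose C hC hCA using hA'
  have hemb := MeasurableEmbedding.subtype_coe (measurableSet_I (α := α))
  have hC0 : C 0 = A := by rw [← hCA 0]; rfl
  have hmem : ∀ n (y : I α), (y : ℝ) ∈ Subtype.val '' C n ↔ y ∈ C n := fun n y =>
    Subtype.val_injective.mem_set_image
  have h := realNu_eq_zero_or_compl hα (B := fun n => Subtype.val '' C n)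
    (fun n => hemb.measurableSet_image.mpr (hC n)) fun n x hx => by
      have h1 := hmem n ((phi α hα)^[n] ⟨x, hx⟩)
      rw [coe_iterate_phi] at h1
      have h2 := hmem 0 ⟨x, hx⟩
      rw [h1, h2, hC0, ← hCA n, mem_preimage]
  simp only [hC0] at h
  refine h.imp (fun h => by rwa [nu_apply hα]) fun h => ?_
  rw [nu_apply hα]
  refine measure_mono_null ?_ h
  rintro _ ⟨y, hy, rfl⟩ hyA
  exact hy (Subtype.val_injective.mem_set_image.mp hyA)

end

/-! ### Exact endomorphisms are mixing of all orders -/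

section

/-- A vector orthogonal to the intersection of a decreasing sequence of closed subspaces is close to
the orthogonal complement of one of them. -/
theorem exists_mem_orthogonal_norm_sub_lt {H : Type*} [NormedAddCommGroup H]
    [InnerProductSpace ℝ H] [CompleteSpace H] {K : ℕ → Submodule ℝ H} (hK : Antitone K)
    (hc : ∀ n, (K n).HasOrthogonalProjection) {f : H} (hf : f ∈ (⨅ n, K n)ᗮ) {ε : ℝ}
    (hε : 0 < ε) : ∃ N, ∃ f' ∈ (K N)ᗮ, ‖f - f'‖ < ε := by
  have h1 : (⨅ n, K n) = (⨆ n, (K n)ᗮ)ᗮ := by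
    rw [← Submodule.iInf_orthogonal]
    exact iInf_congr fun n => (Submodule.orthogonal_orthogonal (K n)).symm
  rw [h1, Submodule.orthogonal_orthogonal_eq_closure, ← SetLike.mem_coe,
    Submodule.topologicalClosure_coe, Metric.mem_closure_iff] at hf
  obtain ⟨f', hf', hd⟩ := hf ε hε
  have hmono : Monotone fun n => (K n)ᗮ := fun i j hij => Submodule.orthogonal_le (hK hij)
  rw [SetLike.mem_coe, Submodule.mem_iSup_of_directed _ hmono.directed_le] at hf'
  obtain ⟨N, hN⟩ := hf'
  exact ⟨N, f', hN, by rwa [← dist_eq_norm]⟩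

variable {X : Type*} [m : MeasurableSpace X] {T : X → X} {μ : Measure X}

theorem comap_iterate_le (hT : Measurable T) (n : ℕ) :
    MeasurableSpace.comap (T^[n]) m ≤ m :=
  (hT.iterate n).comap_le

theorem comap_iterate_antitone (hT : Measurable T) :
    Antitone fun n => MeasurableSpace.comap (T^[n]) m := by
  refine antitone_nat_of_succ_le fun n => ?_
  rw [Function.iterate_succ', ← MeasurableSpace.comap_comp]
  exact MeasurableSpace.comap_mono hT.comap_le

/-- A function measurable, up to null sets, with respect to all the `σ`-algebras `T⁻ⁿ 𝓑` of an exact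
endomorphism is almost everywhere constant. -/
theorem IsExact.ae_eq_const [IsProbabilityMeasure μ] (h : IsExact T μ) {g : X → ℝ}
    (hg : ∀ n : ℕ, AEStronglyMeasurable[MeasurableSpace.comap (T^[n]) m] g μ) :
    ∃ c, g =ᵐ[μ] Function.const X c := by
  choose u hu hgu using hg
  refine Filter.exists_eventuallyEq_const_of_forall_separating MeasurableSet fun U hU => ?_
  -- The limsup set does not see finitely many versions `u n`, hence is exactly tail measurable, and
  -- it agrees almost everywhere with `g ⁻¹' U`.
  set L : Set X := ⋂ N : ℕ, ⋃ n ≥ N, u n ⁻¹' U with hL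
  have hLtail : MeasurableSet[tailSigmaAlgebra T] L := by
    refine MeasurableSpace.measurableSet_iInf.mpr fun M => ?_
    have hLM : L = ⋂ N : ℕ, ⋃ n ≥ max N M, u n ⁻¹' U := by
      ext x
      simp only [hL, mem_iInter, mem_iUnion]
      constructor
      · exact fun hx N => hx (max N M)
      · intro hx N
        obtain ⟨n, hn, hxn⟩ := hx N
        exact ⟨n, le_trans (le_max_left _ _) hn, hxn⟩
    rw [hLM]
    refine MeasurableSet.iInter fun N => MeasurableSet.iUnion fun n => MeasurableSet.iUnion
      fun hn => ?_
    exact comap_iterate_antitone h.1.measurable (le_trans (le_max_right _ _) hn) _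
      ((hu n).measurable hU)
  have hae : ∀ᵐ x ∂μ, x ∈ L ↔ g x ∈ U := by
    filter_upwards [ae_all_iff.mpr hgu] with x hx
    simp only [hL, mem_iInter, mem_iUnion, mem_preimage, ← hx]
    exact ⟨fun h => (h 0).choose_spec.choose_spec, fun h N => ⟨N, le_rfl, h⟩⟩
  rcases h.2 L hLtail with h0 | h0
  · right
    filter_upwards [hae, measure_eq_zero_iff_ae_notMem.mp h0] with x hx hxL
    exact fun hU => hxL (hx.mpr hU)
  · left
    filter_upwards [hae, measure_eq_zero_iff_ae_notMem.mp h0] with x hx hxL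
    exact hx.mp (not_not.mp hxL)

/-- The centred indicator of `A` is orthogonal to the constants, hence to the intersection of the
spaces `L²(T⁻ⁿ 𝓑)`, so it is `ε`-close to a vector orthogonal to one of them. Cauchy–Schwarz against
the indicator of `T⁻ⁿ C`, of norm at most `1`, gives a bound uniform in `C`. -/
theorem IsExact.exists_forall_abs_sub_lt [IsProbabilityMeasure μ] (h : IsExact T μ) {A : Set X}
    (hA : MeasurableSet A) {ε : ℝ} (hε : 0 < ε) :
    ∃ N, ∀ n ≥ N, ∀ C, MeasurableSet C →
      |μ.real (A ∩ T^[n] ⁻¹' C) - μ.real A * μ.real C| < ε := by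
  have hle := comap_iterate_le (m := m) h.1.measurable
  let K : ℕ → Submodule ℝ (Lp ℝ 2 μ) := fun n =>
    lpMeas ℝ ℝ (MeasurableSpace.comap (T^[n]) m) 2 μ
  have hKanti : Antitone K := by
    intro i j hij g hg
    rw [mem_lpMeas_iff_aestronglyMeasurable] at hg ⊢
    exact hg.mono (comap_iterate_antitone h.1.measurable hij)
  have hKc : ∀ n, (K n).HasOrthogonalProjection := fun n => by
    have : Fact (MeasurableSpace.comap (T^[n]) m ≤ m) := ⟨hle n⟩
    infer_instance
  let a : Lp ℝ 2 μ := indicatorConstLp 2 hA (measure_ne_top μ A) 1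
  let e : Lp ℝ 2 μ := indicatorConstLp 2 MeasurableSet.univ (measure_ne_top μ univ) 1
  have hf : a - μ.real A • e ∈ (⨅ n, K n)ᗮ := by
    rw [Submodule.mem_orthogonal']
    intro g hg
    rw [Submodule.mem_iInf] at hg
    obtain ⟨c, hc⟩ := h.ae_eq_const fun n => mem_lpMeas_iff_aestronglyMeasurable.mp (hg n)
    rw [inner_sub_left, inner_smul_left, L2.inner_indicatorConstLp_one,
      L2.inner_indicatorConstLp_one, integral_congr_ae (ae_restrict_of_ae hc),
      integral_congr_ae (ae_restrict_of_ae hc)]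
    simp
  obtain ⟨N, f', hf', hd⟩ := exists_mem_orthogonal_norm_sub_lt hKanti hKc hf hε
  refine ⟨N, fun n hn C hC => ?_⟩
  have hD : MeasurableSet[MeasurableSpace.comap (T^[n]) m] (T^[n] ⁻¹' C) := ⟨C, hC, rfl⟩
  have hDm := hle n _ hD
  let d : Lp ℝ 2 μ := indicatorConstLp 2 hDm (measure_ne_top μ _) 1
  have hd' : d ∈ K N := hKanti hn (mem_lpMeas_indicatorConstLp (hle n) hD (measure_ne_top μ _))
  have hdnorm : ‖d‖ ≤ 1 := by
    refine norm_indicatorConstLp_le.trans ?_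
    rw [norm_one, one_mul]
    exact Real.rpow_le_one measureReal_nonneg measureReal_le_one (by positivity)
  have hinner : inner ℝ (a - μ.real A • e) d =
      μ.real (A ∩ T^[n] ⁻¹' C) - μ.real A * μ.real C := by
    have hpres : μ.real (T^[n] ⁻¹' C) = μ.real C := by
      rw [measureReal_def, (h.1.iterate n).measure_preimage hC.nullMeasurableSet, measureReal_def]
    rw [inner_sub_left, inner_smul_left, L2.inner_indicatorConstLp_one_indicatorConstLp_one,
      L2.inner_indicatorConstLp_one_indicatorConstLp_one, univ_inter, hpres]
    simp
  have hinner' : inner ℝ (a - μ.real A • e - f') d = inner ℝ (a - μ.real A • e) d := by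
    rw [inner_sub_left _ f', (Submodule.mem_orthogonal' _ _).mp hf' d hd', sub_zero]
  rw [← hinner, ← hinner']
  calc _ ≤ ‖a - μ.real A • e - f'‖ * ‖d‖ := abs_real_inner_le_norm _ _
    _ ≤ ‖a - μ.real A • e - f'‖ * 1 := by gcongr
    _ < ε := by rwa [mul_one]

/-- An exact endomorphism is mixing of all orders. -/
theorem IsExact.isMixingOfAllOrders [IsProbabilityMeasure μ] (h : IsExact T μ) :
    IsMixingOfAllOrders T μ := by
  refine ⟨h.1, fun r => ?_⟩
  have hpres : ∀ (n : ℕ) {C : Set X}, MeasurableSet C → μ.real (T^[n] ⁻¹' C) = μ.real C :=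
    fun n C hC => by
      rw [measureReal_def, (h.1.iterate n).measure_preimage hC.nullMeasurableSet, measureReal_def]
  induction r with
  | zero =>
    intro A hA ε hε
    refine ⟨0, fun n _ => ?_⟩
    have e : (⋂ i, T^[n i] ⁻¹' A i) = T^[n 0] ⁻¹' A 0 := by
      ext x; simp [Fin.forall_fin_one]
    rw [e, hpres _ (hA 0)]
    simpa using hε
  | succ r ih =>
    intro A hA ε hε
    obtain ⟨N₁, h₁⟩ := h.exists_forall_abs_sub_lt (hA 0) (half_pos hε)
    obtain ⟨N₂, h₂⟩ := ih (fun i => A i.succ) (fun i => hA _) (ε / 2) (half_pos hε)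
    refine ⟨max N₁ N₂, fun n hn => ?_⟩
    have hmono : Monotone n := Fin.monotone_iff_le_succ.mpr fun i =>
      (Nat.le_add_right _ _).trans (hn i)
    -- All later events, viewed from time `n 1`. This set depends on the times `n i`, which is why
    -- the uniformity in `C` above is essential.
    let C : Set X := ⋂ i : Fin (r + 1), T^[n i.succ - n 1] ⁻¹' A i.succ
    have hC : MeasurableSet C := MeasurableSet.iInter fun i =>
      h.1.measurable.iterate _ (hA _)
    have hle1 : ∀ i : Fin (r + 1), n 1 ≤ n i.succ := fun i => hmono (by
      rw [← Fin.succ_zero_eq_one]; exact Fin.succ_le_succ_iff.mpr (Fin.zero_le _))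
    have h01 : n 0 + max N₁ N₂ ≤ n 1 := hn 0
    have e1 : (⋂ i, T^[n i] ⁻¹' A i) = T^[n 0] ⁻¹' (A 0 ∩ T^[n 1 - n 0] ⁻¹' C) := by
      ext x
      simp only [mem_iInter, mem_preimage, Fin.forall_fin_succ (n := r + 1), mem_inter_iff, C,
        ← Function.iterate_add_apply]
      refine and_congr Iff.rfl (forall_congr' fun i => ?_)
      have := hle1 i
      rw [show n i.succ - n 1 + (n 1 - n 0 + n 0) = n i.succ by omega]
    have e2 : (⋂ i : Fin (r + 1), T^[n i.succ] ⁻¹' A i.succ) = T^[n 1] ⁻¹' C := by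
      ext x
      simp only [mem_iInter, mem_preimage, C, ← Function.iterate_add_apply]
      refine forall_congr' fun i => ?_
      rw [Nat.sub_add_cancel (hle1 i)]
    have k1 := h₁ (n 1 - n 0) (by have := le_max_left N₁ N₂; omega) C hC
    have k2 := h₂ (fun i => n i.succ) fun i => by
      have := hn i.succ
      rw [← Fin.succ_castSucc] at this
      exact le_trans (Nat.add_le_add_left (le_max_right _ _) _) this
    rw [e2, hpres _ hC] at k2
    rw [e1, hpres _ ((hA 0).inter (h.1.measurable.iterate _ hC)), Fin.prod_univ_succ]
    set P := ∏ i : Fin (r + 1), μ.real (A i.succ)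
    have hA1 : μ.real (A 0) ≤ 1 := measureReal_le_one
    calc |μ.real (A 0 ∩ T^[n 1 - n 0] ⁻¹' C) - μ.real (A 0) * P|
        = |(μ.real (A 0 ∩ T^[n 1 - n 0] ⁻¹' C) - μ.real (A 0) * μ.real C) +
            μ.real (A 0) * (μ.real C - P)| := by congr 1; ring
      _ ≤ |μ.real (A 0 ∩ T^[n 1 - n 0] ⁻¹' C) - μ.real (A 0) * μ.real C| +
            μ.real (A 0) * |μ.real C - P| := by
          refine (abs_add_le _ _).trans ?_
          rw [abs_mul, abs_of_nonneg (measureReal_nonneg : 0 ≤ μ.real (A 0))]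
      _ ≤ |μ.real (A 0 ∩ T^[n 1 - n 0] ⁻¹' C) - μ.real (A 0) * μ.real C| + 1 * |μ.real C - P| := by
          gcongr
      _ < ε := by linarith

end

end OddCF

theorem theorem16 (α : ℝ) (hα : α ∈ Set.Icc OddCF.g OddCF.G) :
    MeasureTheory.IsProbabilityMeasure (OddCF.nu α) ∧
      (OddCF.nu α).map Subtype.val ≪ (MeasureTheory.volume : MeasureTheory.Measure ℝ) ∧
      OddCF.IsExact (OddCF.phi α hα) (OddCF.nu α) ∧
      OddCF.IsMixingOfAllOrders (OddCF.phi α hα) (OddCF.nu α) := by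
  have := OddCF.isProbabilityMeasure_nu hα
  exact ⟨this, OddCF.map_nu_absolutelyContinuous hα, OddCF.isExact_phi hα,
    (OddCF.isExact_phi hα).isMixingOfAllOrders⟩
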